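/- **Theorem (Optimal retrieving strategy).** Let $G$ be a compact group with normalized Haar measure $dg$, let $g\mapsto U_g$ be a continuous unitary representation of $G$ on $\mathbb C^d$, $d\ge 1$, and let $N\ge 0$. For a matrix $A$ write $|A\rangle\!\rangle=\sum_{m,n}\langle m|A|n\rangle\,|m\rangle|n\rangle$. Let $(U_j)_j$, of dimensions $d_j$, be a complete list of pairwise inequivalent irreducible unitary matrix representations contained in $U^{\otimes N}$, and let $(p_j)_j$ be any probability distribution on the indices $j$. On the memory space $\widetilde{\mathcal H}=\bigoplus_j \mathbb C^{d_j}\otimes\mathbb C^{d_j}$ consider the input state $|\varphi\rangle=\bigoplus_j\sqrt{p_j/d_j}\,|I_j\rangle\!\rangle$ and, for $g\in G$, the memory state $$|\varphi_g\rangle=\bigoplus_j (U_{j,g}\otimes I_j)\,|\varphi\rangle=\bigoplus_j\sqrt{p_j/d_j}\,|U_{j,g}\rangle\!\rangle ,$$ in which the $N$ uses of the unknown unitary $U_g$ have been stored. For a retrieving channel $\mathcal R$ (a completely positive trace-preserving map from operators on $\mathbb C^d\otimes\widetilde{\mathcal H}$ to operators on $\mathbb C^d$) let $C_g$ be the Choi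 operator of the retrieved channel $\rho\mapsto\mathcal R(\rho\otimes|\varphi_g\rangle\langle\varphi_g|)$, and define the learning fidelity $$F(\mathcal R)=\frac1{d^2}\int_G\langle\!\langle U_g|\,C_g\,|U_g\rangle\!\rangle\,dg .$$ For a POVM $P$ on $\widetilde{\mathcal H}$ with outcomes in $G$ define the estimation fidelity $$F_{\rm est}(P)=\int_G\int_G\Big(\frac{|\mathrm{Tr}[U_g^\dagger U_{\hat g}]|}{d}\Big)^2\,\langle\varphi_g|P(d\hat g)|\varphi_g\rangle\,dg .$$ Let $|\eta_{\hat g}\rangle=\bigoplus_j\sqrt{d_j}\,|U_{j,\hat g}\rangle\!\rangle$. Then: 1. $P_{\hat g}\,d\hat g=|\eta_{\hat g}\rangle\langle\eta_{\hat g}|\,d\hat g$ is a POVM, and the measure-and-rotate map $\mathcal R_*(\rho)=\int_G U_{\hat g}\,\mathrm{Tr}_{\widetilde{\mathcal H}}[(I\otimes|\eta_{\hat g}\rangle\langle\eta_{\hat g}|)\rho]\,U_{\hat g}^\dagger\,d\hat g$ (measure the memory and, on outcome $\hat g$, apply $U_{\hat g}$ to the new input system) is a quantum channel. 2. $\mathcal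 R_*$ is an optimal retrieving channel: $F(\mathcal R)\le F(\mathcal R_*)$ for every retrieving channel $\mathcal R$. 3. The POVM in 1 is optimal for estimation: $F_{\rm est}(P')\le F_{\rm est}(P)$ for every POVM $P'$ on $\widetilde{\mathcal H}$ with outcomes in $G$. 4. The optimal learning fidelity for this memory state equals the optimal estimation fidelity, and $$F(\mathcal R_*)=F_{\rm est}(P)=\sum_K\frac{\big(\sum_{j\in\mathsf P_{KK}}m_K^{(j)}\sqrt{p_j}\big)^2}{d^2},$$ where $(U_K)_K$ is a complete list of pairwise inequivalent irreducible unitary representations contained in at least one of the representations $U\otimes U_j^*$, $m_K^{(j)}$ is the multiplicity of $U_K$ in $U\otimes U_j^*$, and $\mathsf P_{KK}$ is the set of those $j$ for which the irreducible representation $U_K\otimes V_K^*$ of $G\times G$ is contained in $U\otimes V^*\otimes U_j^*\otimes V_j$ (with $U$, $V$ standing for the same representation of the first and second factor of $G\times G$). -/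

import Mathlib

open scoped Kronecker Matrix

namespace UnitaryLearning

open MeasureTheory
open scoped ComplexOrder

noncomputable section

/-! ### Finite-dimensional unitary representations -/

/-- A unitary representation of `G` by matrices indexed by `n`. -/
abbrev URep (G : Type*) [Group G] (n : Type*) [Fintype n] [DecidableEq n] :=
  G →* Matrix.unitaryGroup n ℂ

/-- The linear representation on `ℂⁿ` underlying a matrix representation. -/
def URep.toRep {G : Type*} [Group G] {n : Type*} [Fintype n] [DecidableEq n]
    (U : URep G n) : Representation ℂ G (n → ℂ) where
  toFun g := Matrix.toLin' (U g : Matrix n n ℂ)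
  map_one' := by
    rw [map_one]
    exact Matrix.toLin'_one
  map_mul' g h := by
    rw [map_mul]
    exact Matrix.toLin'_mul _ _

/-- The tensor product `U ⊗ V`. -/
def URep.tensor {G : Type*} [Group G] {m n : Type*} [Fintype m] [DecidableEq m]
    [Fintype n] [DecidableEq n] (U : URep G m) (V : URep G n) : URep G (m × n) where
  toFun g := ⟨(U g : Matrix m m ℂ) ⊗ₖ (V g : Matrix n n ℂ),
    Matrix.kronecker_mem_unitary (U g).2 (V g).2⟩
  map_one' := by
    apply Subtype.ext
    simp
  map_mul' g h := by
    apply Subtype.ext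
    simp [Matrix.mul_kronecker_mul]

/-- The complex conjugate representation `U*` (entrywise conjugation in the given basis). -/
def URep.conj {G : Type*} [Group G] {n : Type*} [Fintype n] [DecidableEq n]
    (U : URep G n) : URep G n where
  toFun g := ⟨(U g : Matrix n n ℂ).map (starRingEnd ℂ), by
    have h := Matrix.mem_unitaryGroup_iff.1 (U g).2
    rw [Matrix.mem_unitaryGroup_iff]
    have h2 := congrArg (fun M : Matrix n n ℂ => M.map (starRingEnd ℂ)) h
    simp only [Matrix.map_mul] at h2
    have h3 : star ((U g : Matrix n n ℂ).map (starRingEnd ℂ))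
        = (star (U g : Matrix n n ℂ)).map (starRingEnd ℂ) := by
      ext i j
      simp [Matrix.star_apply]
    rw [h3, h2]
    exact Matrix.map_one _ (map_zero (starRingEnd ℂ)) (map_one (starRingEnd ℂ))⟩
  map_one' := by
    apply Subtype.ext
    rw [map_one]
    exact Matrix.map_one _ (map_zero (starRingEnd ℂ)) (map_one (starRingEnd ℂ))
  map_mul' g h := by
    apply Subtype.ext
    simp [Matrix.map_mul]

/-- The `N`-fold tensor power `U^{⊗N}`, acting on `(ℂⁿ)^{⊗N}` with product basis `Fin N → n`. -/
def URep.tensorPow {G : Type*} [Group G] {n : Type*} [Fintype n] [DecidableEq n]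
    (U : URep G n) (N : ℕ) : URep G (Fin N → n) :=
  have hmul : ∀ A B : Matrix n n ℂ,
      (Matrix.of fun x y : Fin N → n => ∏ k, A (x k) (y k)) *
        (Matrix.of fun x y : Fin N → n => ∏ k, B (x k) (y k)) =
      Matrix.of fun x y : Fin N → n => ∏ k, (A * B) (x k) (y k) := by
    intro A B
    ext x y
    simp only [Matrix.mul_apply, Matrix.of_apply, ← Finset.prod_mul_distrib]
    rw [Finset.prod_univ_sum]
    simp
  have hone : (Matrix.of fun x y : Fin N → n => ∏ k, (1 : Matrix n n ℂ) (x k) (y k)) = 1 := by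
    ext x y
    simp only [Matrix.of_apply, Matrix.one_apply, Finset.prod_ite_zero, Finset.prod_const_one]
    simp [funext_iff]
  { toFun := fun g => ⟨Matrix.of fun x y => ∏ k, (U g : Matrix n n ℂ) (x k) (y k), by
      rw [Matrix.mem_unitaryGroup_iff]
      have hs : star (Matrix.of fun x y : Fin N → n => ∏ k, (U g : Matrix n n ℂ) (x k) (y k))
          = Matrix.of fun x y : Fin N → n =>
              ∏ k, (star (U g : Matrix n n ℂ)) (x k) (y k) := by
        ext x y
        simp [Matrix.star_apply]
      rw [hs, hmul, Matrix.mem_unitaryGroup_iff.1 (U g).2, hone]⟩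
    map_one' := by
      apply Subtype.ext
      simpa using hone
    map_mul' := by
      intro g h
      apply Subtype.ext
      simpa using (hmul (U g : Matrix n n ℂ) (U h : Matrix n n ℂ)).symm }

/-- `V` is contained in the representation `T`, i.e. is equivalent to a subrepresentation of it. -/
def Contained {G : Type*} [Group G] {m n : Type*} [Fintype m] [DecidableEq m]
    [Fintype n] [DecidableEq n] (V : URep G m) (T : URep G n) : Prop :=
  ∃ f : V.toRep.IntertwiningMap T.toRep, Function.Injective f

/-- The multiplicity of an irreducible representation `V` in `T`. -/
def multiplicity {G : Type*} [Group G] {m n : Type*} [Fintype m] [DecidableEq m]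
    [Fintype n] [DecidableEq n] (V : URep G m) (T : URep G n) : ℕ :=
  Module.finrank ℂ (V.toRep.IntertwiningMap T.toRep)

/-- `(V j)_j` is a complete list, without repetitions up to equivalence, of the irreducible
representations occurring in the decomposition of at least one of the representations `T a`. -/
structure IsIrrList {G : Type*} [Group G] [TopologicalSpace G]
    {ι : Type*} {dim : ι → ℕ} (V : (j : ι) → URep G (Fin (dim j)))
    {α : Type*} {n : α → Type*} [∀ a, Fintype (n a)] [∀ a, DecidableEq (n a)]
    (T : (a : α) → URep G (n a)) : Prop where
  continuous : ∀ j, Continuous (V j)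
  irreducible : ∀ j, (V j).toRep.IsIrreducible
  inequivalent : ∀ j j', j ≠ j' → IsEmpty ((V j).toRep.Equiv (V j').toRep)
  contained : ∀ j, ∃ a, Contained (V j) (T a)
  complete : ∀ (k : ℕ) (W : URep G (Fin k)), Continuous W → W.toRep.IsIrreducible →
    (∃ a, Contained W (T a)) → ∃ j, Nonempty (W.toRep.Equiv (V j).toRep)

/-! ### Vectors, channels, measurements -/

/-- The bipartite vector `|A⟩⟩ = ∑ ⟨m|A|n⟩ |m⟩|n⟩`. -/
def dket {m n : Type*} (A : Matrix m n ℂ) : m × n → ℂ := fun x => A x.1 x.2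

/-- The rank-one operator `|v⟩⟨v|`. -/
def ketbra {n : Type*} (v : n → ℂ) : Matrix n n ℂ := Matrix.vecMulVec v (star v)

/-- The partial trace over the second tensor factor. -/
def traceRight {m n : Type*} [Fintype n] (X : Matrix (m × n) (m × n) ℂ) : Matrix m m ℂ :=
  Matrix.of fun x y => ∑ k, X (x, k) (y, k)

/-- The extension `C ⊗ id` of a map `C` on operators by an additional system. -/
def ampliate {m n : Type*} (C : Matrix m m ℂ →ₗ[ℂ] Matrix n n ℂ) (k : Type*)
    (X : Matrix (m × k) (m × k) ℂ) : Matrix (n × k) (n × k) ℂ :=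
  Matrix.of fun x y => C (Matrix.of fun a b => X (a, x.2) (b, y.2)) x.1 y.1

/-- The Choi operator `(C ⊗ id)(|I⟩⟩⟨⟨I|)`. -/
def choi {m n : Type*} [DecidableEq m] (C : Matrix m m ℂ →ₗ[ℂ] Matrix n n ℂ) :
    Matrix (n × m) (n × m) ℂ :=
  ampliate C m (ketbra (dket (1 : Matrix m m ℂ)))

/-- A quantum channel from `Lin(ℂᵐ)` to `Lin(ℂⁿ)`: a completely positive trace-preserving map. -/
structure QChannel (m n : Type*) [Fintype m] [Fintype n] where
  toLin : Matrix m m ℂ →ₗ[ℂ] Matrix n n ℂ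
  completelyPositive : ∀ (k : ℕ) (X : Matrix (m × Fin k) (m × Fin k) ℂ),
    X.PosSemidef → (ampliate toLin (Fin k) X).PosSemidef
  tracePreserving : ∀ X, (toLin X).trace = X.trace

/-- A POVM on the outcome space `Ω` for the system `ℂⁿ`: a normalized countably additive measure
with values in the positive operators. -/
structure POVM (Ω : Type*) [MeasurableSpace Ω] (n : Type*) [Fintype n] [DecidableEq n] where
  effect : VectorMeasure Ω (Matrix n n ℂ)
  posSemidef : ∀ B, (effect B).PosSemidef
  normalized : effect Set.univ = 1

/-- The map `M ↦ ⟨ψ|M|ψ⟩` (real part). -/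
def expectation {n : Type*} [Fintype n] (ψ : n → ℂ) : Matrix n n ℂ →+ ℝ where
  toFun M := (star ψ ⬝ᵥ (M *ᵥ ψ)).re
  map_zero' := by simp
  map_add' A B := by simp [Matrix.add_mulVec, dotProduct_add]

/-- The outcome law `B ↦ ⟨ψ|P(B)|ψ⟩` of the POVM `P` performed on the state `ψ`. -/
def POVM.law {Ω : Type*} [MeasurableSpace Ω] {n : Type*} [Fintype n] [DecidableEq n]
    (P : POVM Ω n) (ψ : n → ℂ) : Measure Ω :=
  SignedMeasure.toMeasureOfZeroLE (P.effect.mapRange (expectation ψ) (by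
    change Continuous fun M : Matrix n n ℂ => (star ψ ⬝ᵥ (M *ᵥ ψ)).re
    fun_prop)) Set.univ MeasurableSet.univ (by
      rw [VectorMeasure.le_restrict_univ_iff_le]
      intro B _
      exact (Complex.nonneg_iff.1 ((P.posSemidef B).dotProduct_mulVec_nonneg ψ)).1)

/-- `P` has the operator density `D` with respect to `μ`: `P(B) = ∫_B D(g) dμ(g)`. -/
def POVM.HasDensity {Ω : Type*} [MeasurableSpace Ω] {n : Type*} [Fintype n] [DecidableEq n]
    (P : POVM Ω n) (μ : Measure Ω) (D : Ω → Matrix n n ℂ) : Prop :=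
  ∀ B, MeasurableSet B → ∀ x y,
    IntegrableOn (fun g => D g x y) B μ ∧ P.effect B x y = ∫ g in B, D g x y ∂μ

/-! ### Storing -/

/-- Index set of the product basis of `⊕_j (H_j ⊗ H_j)`. -/
abbrev Mem {ι : Type*} (dim : ι → ℕ) := (j : ι) × (Fin (dim j) × Fin (dim j))

section Storing

variable {G : Type*} [Group G] {ι : Type*} [DecidableEq ι] {dim : ι → ℕ}

/-- The representation `Ũ = ⊕_j (U_j ⊗ I_j)`. -/
def storage (W : (j : ι) → URep G (Fin (dim j))) (g : G) : Matrix (Mem dim) (Mem dim) ℂ :=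
  Matrix.blockDiagonal' fun j => (W j g : Matrix (Fin (dim j)) (Fin (dim j)) ℂ) ⊗ₖ
    (1 : Matrix (Fin (dim j)) (Fin (dim j)) ℂ)

/-- The input state `|φ⟩ = ⊕_j √(p_j / d_j) |I_j⟩⟩`. -/
def inputState (dim : ι → ℕ) (p : ι → ℝ) : Mem dim → ℂ := fun x =>
  (Real.sqrt (p x.1 / dim x.1) : ℂ) * dket (1 : Matrix (Fin (dim x.1)) (Fin (dim x.1)) ℂ) x.2

/-- The memory state `|φ_U⟩ = Ũ |φ⟩`. -/
def memoryState [Fintype ι] (W : (j : ι) → URep G (Fin (dim j))) (p : ι → ℝ) (g : G) :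
    Mem dim → ℂ :=
  storage W g *ᵥ inputState dim p

/-- The vector `|η_U⟩ = ⊕_j √d_j |U_j⟩⟩`. -/
def etaVec (W : (j : ι) → URep G (Fin (dim j))) (g : G) : Mem dim → ℂ := fun x =>
  (Real.sqrt (dim x.1) : ℂ) * dket (W x.1 g : Matrix (Fin (dim x.1)) (Fin (dim x.1)) ℂ) x.2

end Storing

/-! ### Retrieving and estimating -/

/-- The map `ρ ↦ R(ρ ⊗ |ψ⟩⟨ψ|)` obtained from the retrieving channel `R` when the memory is in the
state `ψ`. -/
def retrieved {H M : Type*} [Fintype H] [Fintype M] (R : QChannel (H × M) H) (ψ : M → ℂ) :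
    Matrix H H ℂ →ₗ[ℂ] Matrix H H ℂ where
  toFun ρ := R.toLin (ρ ⊗ₖ ketbra ψ)
  map_add' ρ σ := by simp [Matrix.add_kronecker]
  map_smul' c ρ := by simp [Matrix.smul_kronecker]

section Retrieving

variable {G : Type*} [Group G] [MeasurableSpace G] (μ : Measure G) {d : ℕ} (U : URep G (Fin d))
  {M : Type*} [Fintype M] [DecidableEq M]

/-- The average over `G` of the channel fidelity `⟨⟨U| C_U |U⟩⟩ / d²` between the retrieved channel
and the target unitary, for the memory states `ψ g`. -/
def learningFidelity (ψ : G → M → ℂ) (R : QChannel (Fin d × M) (Fin d)) : ℝ :=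
  (1 / (d : ℝ) ^ 2) *
    ∫ g, expectation (dket (U g : Matrix (Fin d) (Fin d) ℂ)) (choi (retrieved R (ψ g))) ∂μ

/-- The average over `G` of the expected channel fidelity `(|Tr[U_g† U_ĝ]| / d)²` between the true
unitary `U_g` and the unitary `U_ĝ` estimated by the POVM `P`, for the memory states `ψ g`. -/
def estimationFidelity (ψ : G → M → ℂ) (P : POVM G M) : ℝ :=
  ∫ g, ∫ h, (‖((U g : Matrix (Fin d) (Fin d) ℂ)ᴴ * (U h : Matrix (Fin d) (Fin d) ℂ)).trace‖
    / (d : ℝ)) ^ 2 ∂(P.law (ψ g)) ∂μ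

/-- `R` is the measure-and-rotate channel for the operator density `D`: the memory is measured and,
conditionally on the outcome `ĝ`, the unitary `U_ĝ` is applied to the input system,
`R(ρ) = ∫ U_ĝ Tr_M[(I ⊗ D(ĝ)) ρ] U_ĝ† dĝ`. -/
def IsMeasureAndRotate (D : G → Matrix M M ℂ) (R : QChannel (Fin d × M) (Fin d)) : Prop :=
  ∀ ρ x y,
    Integrable (fun g => ((U g : Matrix (Fin d) (Fin d) ℂ) *
      traceRight (((1 : Matrix (Fin d) (Fin d) ℂ) ⊗ₖ D g) * ρ) *
      (U g : Matrix (Fin d) (Fin d) ℂ)ᴴ) x y) μ ∧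
    R.toLin ρ x y = ∫ g, ((U g : Matrix (Fin d) (Fin d) ℂ) *
      traceRight (((1 : Matrix (Fin d) (Fin d) ℂ) ⊗ₖ D g) * ρ) *
      (U g : Matrix (Fin d) (Fin d) ℂ)ᴴ) x y ∂μ

end Retrieving

section Value

variable {G : Type*} [Group G] {d : ℕ} (U : URep G (Fin d))
  {ι : Type*} {dim : ι → ℕ} (W : (j : ι) → URep G (Fin (dim j)))
  {κ : Type*} {e : κ → ℕ} (V : (K : κ) → URep G (Fin (e K)))

/-- The set `P_{KL}` of the indices `j` such that the irreducible representation `U_K ⊗ V_L*` of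
`G × G` is contained in `U ⊗ V* ⊗ U_j* ⊗ V_j`. -/
def blockSet (K L : κ) : Set ι :=
  {j | Contained
    (URep.tensor ((V K).comp (MonoidHom.fst G G)) (URep.conj ((V L).comp (MonoidHom.snd G G))))
    (URep.tensor
      (URep.tensor (U.comp (MonoidHom.fst G G)) (URep.conj (U.comp (MonoidHom.snd G G))))
      (URep.tensor (URep.conj ((W j).comp (MonoidHom.fst G G)))
        ((W j).comp (MonoidHom.snd G G))))}

open Classical in
/-- The value `∑_K (∑_{j ∈ P_KK} m_K^{(j)} √p_j)² / d²`, where `m_K^{(j)}` is the multiplicity of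
`U_K` in `U ⊗ U_j*`. -/
def estValue [Fintype ι] [Fintype κ] (p : ι → ℝ) : ℝ :=
  ∑ K : κ, (∑ j ∈ Finset.univ.filter (fun j => j ∈ blockSet U W V K K),
    (multiplicity (V K) (URep.tensor U (URep.conj (W j))) : ℝ) * Real.sqrt (p j)) ^ 2
      / (d : ℝ) ^ 2

end Value

end

end UnitaryLearning

open UnitaryLearning

open scoped Kronecker Matrix

namespace UnitaryLearning

open MeasureTheory
open scoped ComplexOrder

noncomputable section

/-! ### Intertwiners as matrices, and Schur's lemma -/

section Intertwiners

variable {G : Type*} [Group G] {m n : Type*} [Fintype m] [DecidableEq m]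
  [Fintype n] [DecidableEq n] {V : URep G m} {T : URep G n}

/-! Both fidelities are values of one functional. Factor a positive operator as `Bᴴ * B`: the Choi
operator of a retrieving channel, or the effects of a POVM with finitely many outcomes. In either
case `d²` times the fidelity becomes `∑ₖ ∫ |⟨vₖ, |U_g⟩⟩ ⊗ |φ_g*⟩⟩|² dg`, where the `vₖ` live on
output ⊗ (input ⊗ memory) and `∑ₖ |vₖ⟩⟨vₖ|` has the identity as its partial trace over the output.
For a channel this is trace preservation; for estimation it is normalization of the POVM together
with unitarity of the guesses.

Upper bound (`integral_norm_sq_le`, `sum_integral_norm_sq_le`). Up to the factor `√(p_j/d_j)`, the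
entries of `|U_g⟩⟩ ⊗ |φ_g*⟩` are matrix entries of `T_j = U ⊗ U_j*`. Split each `T_j` into
irreducibles by isometric intertwiners `A j K i`. Schur orthogonality turns the integral into `∑_K
‖Y_K‖² / e_K`, where `Y_K` collects the blocks of `vₖ` over all `j` and all copies `i` of `U_K`.
Cauchy–Schwarz over the pairs `(j, i)` with weights `√p_j`, whose total is `s_K = ∑_j m_K^(j) √p_j`,
bounds `‖Y_K‖²` by `s_K` times a weighted sum of the squared norms of the blocks. Enlarging each
block by dropping the isometry on its output side allows the partial trace condition to evaluate the
sum over `k` exactly. The result is `∑_K s_K²`.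

Attainment (`integral_overlap`). For the Kraus operators `U_h ⊗ ⟨η_h|`, the overlap with `|U_g⟩⟩ ⊗
|φ_g*⟩` has modulus `|χ_U ∑_j √p_j conj χ_j|` at `g⁻¹h`. The function inside the modulus is `∑_K s_K
χ_K`, so orthogonality of characters gives `∑_K s_K²`. Measuring `η` and counting the squared trace
overlap of guess and truth yields the same integrand, hence the same value for estimation.

An arbitrary POVM is reduced to finitely many outcomes by a uniform approximation of the fidelity in
its second variable. -/

theorem URep.toRep_apply (T : URep G n) (g : G) (v : n → ℂ) :
    T.toRep g v = (T g : Matrix n n ℂ) *ᵥ v := by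
  simp [URep.toRep]

/-- The intertwining map given by a matrix that commutes with the actions. -/
def intertwinerOfMatrix (A : Matrix n m ℂ)
    (hA : ∀ g, (T g : Matrix n n ℂ) * A = A * (V g : Matrix m m ℂ)) :
    V.toRep.IntertwiningMap T.toRep :=
  LinearMap.intertwiningMap_of_isIntertwiningMap V.toRep T.toRep (Matrix.toLin' A) (by
    intro g v
    simp [URep.toRep_apply, hA])

theorem intertwinerOfMatrix_apply (A : Matrix n m ℂ)
    (hA : ∀ g, (T g : Matrix n n ℂ) * A = A * (V g : Matrix m m ℂ)) (v : m → ℂ) :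
    intertwinerOfMatrix A hA v = A *ᵥ v := by
  simp [intertwinerOfMatrix]

theorem intertwiner_toMatrix' (f : V.toRep.IntertwiningMap T.toRep) (g : G) :
    (T g : Matrix n n ℂ) * LinearMap.toMatrix' f.toLinearMap
      = LinearMap.toMatrix' f.toLinearMap * (V g : Matrix m m ℂ) := by
  have h := congrArg LinearMap.toMatrix' (f.isIntertwining' g)
  rw [LinearMap.toMatrix'_comp, LinearMap.toMatrix'_comp] at h
  simpa [URep.toRep] using h.symm

/-- The matrices that intertwine `V` and `T`, as a subspace of a Euclidean space. -/
def intertwinerSpace (V : URep G m) (T : URep G n) : Submodule ℂ (EuclideanSpace ℂ (n × m)) where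
  carrier := {v | ∀ g, (T g : Matrix n n ℂ) * (Matrix.of fun a b => v (a, b))
    = (Matrix.of fun a b => v (a, b)) * (V g : Matrix m m ℂ)}
  zero_mem' g := by
    have : (Matrix.of fun a b => (0 : EuclideanSpace ℂ (n × m)) (a, b)) = 0 := by
      ext; simp
    rw [this]; simp
  add_mem' {v w} hv hw g := by
    have : (Matrix.of fun a b => (v + w) (a, b))
        = (Matrix.of fun a b => v (a, b)) + Matrix.of fun a b => w (a, b) := by
      ext; simp
    rw [this, Matrix.mul_add, Matrix.add_mul, hv, hw]
  smul_mem' c v hv g := by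
    have : (Matrix.of fun a b => (c • v) (a, b)) = c • (Matrix.of fun a b => v (a, b)) := by
      ext; simp
    rw [this, Matrix.mul_smul, hv, Matrix.smul_mul]

/-- Intertwining maps correspond to intertwining matrices. -/
def intertwinerEquiv (V : URep G m) (T : URep G n) :
    V.toRep.IntertwiningMap T.toRep ≃ₗ[ℂ] intertwinerSpace V T where
  toFun f := ⟨WithLp.toLp 2 fun x => LinearMap.toMatrix' f.toLinearMap x.1 x.2,
    fun g => intertwiner_toMatrix' f g⟩
  map_add' f f' := by
    ext x
    simp
  map_smul' c f := by
    ext x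
    simp [LinearMap.toMatrix'_apply]
  invFun v := intertwinerOfMatrix (Matrix.of fun a b => v.1 (a, b)) v.2
  left_inv f := by
    ext v
    simp [Matrix.toLin'_apply, intertwinerOfMatrix, LinearMap.intertwiningMap_of_isIntertwiningMap]
  right_inv v := by
    ext x
    simp [intertwinerOfMatrix, LinearMap.intertwiningMap_of_isIntertwiningMap]

theorem finrank_intertwinerSpace (V : URep G m) (T : URep G n) :
    Module.finrank ℂ (intertwinerSpace V T) = multiplicity V T :=
  (intertwinerEquiv V T).finrank_eq.symm

theorem intertwiner_eq_zero {V' : URep G n} (hV : V.toRep.IsIrreducible)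
    (hV' : V'.toRep.IsIrreducible) (h : IsEmpty (V.toRep.Equiv V'.toRep)) (A : Matrix n m ℂ)
    (hA : ∀ g, (V' g : Matrix n n ℂ) * A = A * (V g : Matrix m m ℂ)) : A = 0 := by
  have h0 : intertwinerOfMatrix A hA = 0 := Subsingleton.elim _ _
  ext a b
  have := congrArg (fun f => f (Pi.single b 1) a) h0
  simpa [intertwinerOfMatrix_apply] using this

theorem nonempty_of_irreducible (hV : V.toRep.IsIrreducible) : Nonempty m := by
  by_contra hm
  rw [not_nonempty_iff] at hm
  obtain ⟨x, y, hxy⟩ := hV.toNontrivial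
  apply hxy
  ext v
  rw [Subsingleton.elim v 0]
  exact ⟨fun _ => y.toSubmodule.zero_mem, fun _ => x.toSubmodule.zero_mem⟩

/-- Schur's lemma over an algebraically closed field makes `A` a scalar, and taking traces
identifies that scalar. -/
theorem intertwiner_eq_smul_one (hV : V.toRep.IsIrreducible) (A : Matrix m m ℂ)
    (hA : ∀ g, (V g : Matrix m m ℂ) * A = A * (V g : Matrix m m ℂ)) :
    A = (A.trace / Fintype.card m) • (1 : Matrix m m ℂ) := by
  have := nonempty_of_irreducible hV
  obtain ⟨c, hc⟩ := (Representation.IsIrreducible.algebraMap_intertwiningMap_bijective_of_isAlgClosed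
    (ρ := V.toRep)).2 (intertwinerOfMatrix A hA)
  have hAc : A = c • (1 : Matrix m m ℂ) := by
    ext a b
    have := congrArg (fun f => f (Pi.single b 1) a) hc
    rw [intertwinerOfMatrix_apply, Algebra.algebraMap_eq_smul_one] at this
    simpa [Matrix.smul_apply, Matrix.one_apply, Pi.single_apply, eq_comm] using this.symm
  have hm : (Fintype.card m : ℂ) ≠ 0 := by simp
  rw [hAc]
  simp [Matrix.trace_smul, hm]

end Intertwiners

/-! ### Haar averaging and the Schur orthogonality relations -/

section Orthogonality

variable {G : Type*} [Group G] [TopologicalSpace G] [IsTopologicalGroup G]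
    [CompactSpace G] [MeasurableSpace G] [BorelSpace G] (μ : Measure G) [μ.IsHaarMeasure]
    [IsProbabilityMeasure μ]
  {m n : Type*} [Fintype m] [DecidableEq m] [Fintype n] [DecidableEq n]

theorem URep.continuous_apply {G : Type*} [Group G] [TopologicalSpace G] {V : URep G m}
    (hV : Continuous V) (a b : m) :
    Continuous fun g => (V g : Matrix m m ℂ) a b :=
  (show Continuous fun g => (V g : Matrix m m ℂ) from
    Continuous.comp continuous_subtype_val hV).matrix_elem a b

theorem integrable_of_continuous {X E : Type*} [TopologicalSpace X] [CompactSpace X]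
    [MeasurableSpace X] [BorelSpace X] [NormedAddCommGroup E] [SecondCountableTopology E]
    (μ : Measure X) [IsFiniteMeasure μ] {f : X → E} (hf : Continuous f) : Integrable f μ := by
  obtain ⟨C, hC⟩ := isCompact_univ.exists_bound_of_continuousOn hf.continuousOn
  exact Integrable.of_bound hf.aestronglyMeasurable C (.of_forall fun x => hC x trivial)

/-- Left translation by `h` is absorbed by invariance of Haar measure. With a matrix unit for `X`,
the entries of the average are the integrals in the orthogonality relations. -/
theorem average_intertwines {V : URep G m} {T : URep G n} (hV : Continuous V) (hT : Continuous T)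
    (X : Matrix n m ℂ) (h : G) :
    (T h : Matrix n n ℂ) * (Matrix.of fun a b => ∫ g, ((T g : Matrix n n ℂ) * X *
        (V g : Matrix m m ℂ)ᴴ) a b ∂μ)
      = (Matrix.of fun a b => ∫ g, ((T g : Matrix n n ℂ) * X *
        (V g : Matrix m m ℂ)ᴴ) a b ∂μ) * (V h : Matrix m m ℂ) := by
  have hc : ∀ a b, Integrable (fun g => ((T g : Matrix n n ℂ) * X * (V g : Matrix m m ℂ)ᴴ) a b) μ := by
    intro a b
    refine integrable_of_continuous μ ?_
    simp only [Matrix.mul_apply, Matrix.conjTranspose_apply]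
    have := URep.continuous_apply hV
    have := URep.continuous_apply hT
    fun_prop
  ext a b
  have h1 : ((T h : Matrix n n ℂ) * (Matrix.of fun a b => ∫ g, ((T g : Matrix n n ℂ) * X *
        (V g : Matrix m m ℂ)ᴴ) a b ∂μ)) a b
      = ∫ g, ((T h : Matrix n n ℂ) * ((T g : Matrix n n ℂ) * X * (V g : Matrix m m ℂ)ᴴ)) a b ∂μ := by
    simp only [Matrix.mul_apply (M := (T h : Matrix n n ℂ)), Matrix.of_apply]
    rw [integral_finsetSum _ fun c _ => (hc c b).const_mul _]
    simp_rw [integral_const_mul]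
  have h2 : ((Matrix.of fun a b => ∫ g, ((T g : Matrix n n ℂ) * X *
        (V g : Matrix m m ℂ)ᴴ) a b ∂μ) * (V h : Matrix m m ℂ)) a b
      = ∫ g, (((T g : Matrix n n ℂ) * X * (V g : Matrix m m ℂ)ᴴ) * (V h : Matrix m m ℂ)) a b ∂μ := by
    simp only [Matrix.mul_apply (N := (V h : Matrix m m ℂ)), Matrix.of_apply]
    rw [integral_finsetSum _ fun c _ => (hc a c).mul_const _]
    simp_rw [integral_mul_const]
  rw [h1, h2]
  refine Eq.trans ?_ (integral_mul_left_eq_self _ h)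
  congr 1
  ext g
  have hu : (V h : Matrix m m ℂ)ᴴ * (V h : Matrix m m ℂ) = 1 :=
    Matrix.mem_unitaryGroup_iff'.1 (V h).2
  simp only [map_mul, Submonoid.coe_mul, Matrix.conjTranspose_mul, Matrix.mul_assoc, hu, mul_one]

theorem mul_single_mul_conjTranspose_apply (A : Matrix n n ℂ) (B : Matrix m m ℂ) (a b : n)
    (c d : m) : (A * Matrix.single b d (1 : ℂ) * Bᴴ) a c = A a b * starRingEnd ℂ (B c d) := by
  rw [Matrix.mul_assoc, Matrix.mul_apply, Finset.sum_eq_single b]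
  · simp [Matrix.single_mul_apply_same]
  · intro x _ hx
    simp [Matrix.single_mul_apply_of_ne, hx]
  · simp

/-- Matrix entries of inequivalent irreducible representations are orthogonal. -/
theorem integral_entry_mul_conj_entry_of_inequivalent {V : URep G m} {T : URep G n}
    (hV : Continuous V) (hT : Continuous T) (iV : V.toRep.IsIrreducible)
    (iT : T.toRep.IsIrreducible) (h : IsEmpty (V.toRep.Equiv T.toRep)) (a b : n) (c d : m) :
    ∫ g, (T g : Matrix n n ℂ) a b * starRingEnd ℂ ((V g : Matrix m m ℂ) c d) ∂μ = 0 := by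
  have h0 := intertwiner_eq_zero iV iT h _
    (average_intertwines μ hV hT (Matrix.single b d (1 : ℂ)))
  have := congrFun (congrFun h0 a) c
  simpa [mul_single_mul_conjTranspose_apply] using this

/-- The orthogonality relations for the matrix entries of an irreducible representation. -/
theorem integral_entry_mul_conj_entry {V : URep G m} (hV : Continuous V)
    (iV : V.toRep.IsIrreducible) (a b c d : m) :
    ∫ g, (V g : Matrix m m ℂ) a b * starRingEnd ℂ ((V g : Matrix m m ℂ) c d) ∂μ
      = if a = c ∧ b = d then 1 / (Fintype.card m : ℂ) else 0 := by
  have h0 := intertwiner_eq_smul_one iV _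
    (average_intertwines μ hV hV (Matrix.single b d (1 : ℂ)))
  have h1 := congrFun (congrFun h0 a) c
  -- Conjugation by a unitary preserves the trace, so the average has the trace of the matrix unit;
  -- this fixes the scalar in Schur's lemma.
  have htr : (Matrix.of fun a b_1 => ∫ g, ((V g : Matrix m m ℂ) * Matrix.single b d (1 : ℂ) *
      (V g : Matrix m m ℂ)ᴴ) a b_1 ∂μ).trace = if b = d then 1 else 0 := by
    simp only [Matrix.trace, Matrix.diag, Matrix.of_apply]
    rw [← integral_finsetSum]
    · have : ∀ g, ∑ i, ((V g : Matrix m m ℂ) * Matrix.single b d (1 : ℂ) *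
          (V g : Matrix m m ℂ)ᴴ) i i = if b = d then 1 else 0 := by
        intro g
        have hu : (V g : Matrix m m ℂ)ᴴ * (V g : Matrix m m ℂ) = 1 :=
          Matrix.mem_unitaryGroup_iff'.1 (V g).2
        change Matrix.trace _ = _
        rw [Matrix.mul_assoc, Matrix.trace_mul_comm, Matrix.mul_assoc, hu, mul_one]
        split_ifs with hbd
        · subst hbd; simp
        · simp [Matrix.trace_single_eq_of_ne, hbd]
      simp [this]
    · intro i _
      refine integrable_of_continuous μ ?_
      simp only [mul_single_mul_conjTranspose_apply]
      have := URep.continuous_apply hV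
      fun_prop
  rw [htr] at h1
  simp only [Matrix.of_apply, mul_single_mul_conjTranspose_apply] at h1
  rw [h1]
  by_cases h1 : a = c <;> by_cases h2 : b = d <;> simp [h1, h2]

end Orthogonality

/-! ### Irreducible subrepresentations as ranges of isometries -/

section IrreducibleSubrepresentation

variable {G : Type*} [Group G] {m n : Type*} [Fintype m] [DecidableEq m]
  [Fintype n] [DecidableEq n] {T : URep G n}

/-- An orthonormal basis of a subspace, as the columns of a matrix. -/
theorem exists_isometry_range {n : Type*} [Fintype n] (S : Submodule ℂ (n → ℂ)) :
    ∃ (k : ℕ) (A : Matrix n (Fin k) ℂ), Aᴴ * A = 1 ∧ ∀ v, v ∈ S ↔ ∃ w, A *ᵥ w = v := by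
  let S' : Submodule ℂ (EuclideanSpace ℂ n) := S.comap (WithLp.linearEquiv 2 ℂ (n → ℂ)).toLinearMap
  let B := stdOrthonormalBasis ℂ S'
  refine ⟨_, Matrix.of fun a i => (B i : EuclideanSpace ℂ n) a, ?_, ?_⟩
  · ext i j
    have := orthonormal_iff_ite.1 B.orthonormal i j
    rw [Submodule.coe_inner, PiLp.inner_apply] at this
    simp only [Matrix.mul_apply, Matrix.conjTranspose_apply, Matrix.of_apply, Matrix.one_apply,
      ← this]
    refine Finset.sum_congr rfl fun x _ => ?_
    simp [mul_comm]
  · intro v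
    have hmul : ∀ w, (Matrix.of fun a i => (B i : EuclideanSpace ℂ n) a) *ᵥ w
        = WithLp.ofLp ((∑ i, w i • B i : S') : EuclideanSpace ℂ n) := by
      intro w
      ext a
      simp [Matrix.mulVec, dotProduct, mul_comm]
    constructor
    · intro hv
      refine ⟨fun i => B.repr ⟨WithLp.toLp 2 v, hv⟩ i, ?_⟩
      rw [hmul, B.sum_repr]
    · rintro ⟨w, rfl⟩
      rw [hmul]
      exact (∑ i, w i • B i : S').2

/-- A nonzero invariant subspace contains an irreducible one, which is the range of an isometric
intertwiner. -/
theorem exists_irreducible_le [TopologicalSpace G] (hT : Continuous T)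
    (S : Subrepresentation T.toRep) (hS : S ≠ ⊥) :
    ∃ (k : ℕ) (W : URep G (Fin k)) (A : Matrix n (Fin k) ℂ), Continuous W ∧
      W.toRep.IsIrreducible ∧ Aᴴ * A = 1 ∧
      (∀ g, (T g : Matrix n n ℂ) * A = A * (W g : Matrix (Fin k) (Fin k) ℂ)) ∧
      ∀ v, A *ᵥ v ∈ S := by
  -- Finite dimension makes the lattice of subrepresentations well founded, hence atomic; the
  -- irreducible sought is an atom below `S`.
  have hwf : WellFoundedLT (Subrepresentation T.toRep) :=
    StrictMono.wellFoundedLT (f := Subrepresentation.toSubmodule) (fun a b h => h)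
  have : IsAtomic (Subrepresentation T.toRep) := isAtomic_of_orderBot_wellFounded_lt hwf.wf
  obtain ⟨S₀, hS₀, hle⟩ := (eq_bot_or_exists_atom_le S).resolve_left hS
  obtain ⟨k, A, hA, hr⟩ := exists_isometry_range S₀.toSubmodule
  have hproj : ∀ v ∈ S₀.toSubmodule, A *ᵥ (Aᴴ *ᵥ v) = v := by
    intro v hv
    obtain ⟨w, rfl⟩ := (hr v).1 hv
    rw [Matrix.mulVec_mulVec _ Aᴴ, hA, Matrix.one_mulVec]
  -- `A * Aᴴ` fixes the range of `A`, which `T g` preserves. This one identity makes the compression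
  -- `Aᴴ * T g * A` both unitary and multiplicative.
  have hinv : ∀ g, A * (Aᴴ * ((T g : Matrix n n ℂ) * A)) = (T g : Matrix n n ℂ) * A := by
    intro g
    refine Matrix.toLin'.injective (LinearMap.ext fun v => ?_)
    simp only [Matrix.toLin'_apply, ← Matrix.mulVec_mulVec]
    apply hproj
    rw [← URep.toRep_apply]
    exact S₀.apply_mem_toSubmodule g ((hr _).2 ⟨v, rfl⟩)
  let W : URep G (Fin k) :=
    { toFun := fun g => ⟨Aᴴ * ((T g : Matrix n n ℂ) * A), by
        have hu : (T g : Matrix n n ℂ)ᴴ * (T g : Matrix n n ℂ) = 1 :=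
          Matrix.mem_unitaryGroup_iff'.1 (T g).2
        rw [Matrix.mem_unitaryGroup_iff', Matrix.star_eq_conjTranspose, Matrix.conjTranspose_mul,
          Matrix.conjTranspose_conjTranspose, Matrix.mul_assoc, hinv, Matrix.conjTranspose_mul,
          Matrix.mul_assoc, ← Matrix.mul_assoc _ _ A, hu, Matrix.one_mul, hA]⟩
      map_one' := by
        apply Subtype.ext
        simp [hA]
      map_mul' := by
        intro g h
        apply Subtype.ext
        simp only [map_mul, Submonoid.coe_mul]
        rw [Matrix.mul_assoc Aᴴ, Matrix.mul_assoc _ A, hinv h, Matrix.mul_assoc] }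
  have hW : ∀ g, (T g : Matrix n n ℂ) * A = A * (W g : Matrix (Fin k) (Fin k) ℂ) :=
    fun g => (hinv g).symm
  refine ⟨k, W, A, ?_, ?_, hA, hW, fun v => hle ((hr _).2 ⟨v, rfl⟩)⟩
  · refine Continuous.subtype_mk ?_ _
    have := continuous_subtype_val.comp hT
    exact Continuous.matrix_mul continuous_const (Continuous.matrix_mul this continuous_const)
  · have hinj : ∀ v w, A *ᵥ v = A *ᵥ w → v = w := by
      intro v w h
      have := congrArg (Aᴴ *ᵥ ·) h
      simpa [Matrix.mulVec_mulVec, hA] using this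
    refine { exists_pair_ne := ⟨⊥, ⊤, fun h => hS₀.1 ?_⟩, eq_bot_or_eq_top := fun Q => ?_ }
    · ext v
      constructor
      · intro hv
        obtain ⟨w, rfl⟩ := (hr v).1 hv
        have hw : w ∈ (⊤ : Subrepresentation W.toRep) := trivial
        rw [← h] at hw
        have hw0 : w = 0 := hw
        rw [hw0, Matrix.mulVec_zero]
        exact Submodule.zero_mem _
      · intro hv
        have hv0 : v = 0 := hv
        rw [hv0]
        exact Submodule.zero_mem _
    -- The image under `A` of a subrepresentation of `W` lies below the atom, so it is zero or all
    -- of it; injectivity of `A` transfers the alternative back.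
    · let Q' : Subrepresentation T.toRep :=
        { toSubmodule := Q.toSubmodule.map (Matrix.toLin' A)
          apply_mem_toSubmodule := by
            rintro g _ ⟨w, hw, rfl⟩
            refine ⟨W.toRep g w, Q.apply_mem_toSubmodule g hw, ?_⟩
            simp [URep.toRep_apply, hW] }
      have hQ' : Q' ≤ S₀ := by
        rintro _ ⟨w, hw, rfl⟩
        exact (hr _).2 ⟨w, by simp⟩
      rcases hS₀.le_iff.1 hQ' with h | h
      · left
        ext v
        constructor
        · intro hv
          have h1 : A *ᵥ v ∈ Q' := ⟨v, hv, by simp⟩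
          rw [h] at h1
          have h2 : A *ᵥ v = 0 := h1
          exact hinj v 0 (by rw [h2, Matrix.mulVec_zero])
        · intro hv
          have hv0 : v = 0 := hv
          rw [hv0]
          exact Submodule.zero_mem _
      · right
        ext v
        refine ⟨fun _ => trivial, fun _ => ?_⟩
        have h1 : A *ᵥ v ∈ S₀ := (hr _).2 ⟨v, rfl⟩
        rw [← h] at h1
        obtain ⟨w, hw, hwv⟩ := h1
        rw [Matrix.toLin'_apply] at hwv
        rw [← hinj _ _ hwv]
        exact hw

end IrreducibleSubrepresentation

/-! ### Isotypic components and complete reducibility -/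

section Decomposition

variable {G : Type*} [Group G] {m n : Type*} [Fintype m] [DecidableEq m]
  [Fintype n] [DecidableEq n]

/-- Take adjoints of the relation at `g⁻¹` and use unitarity. -/
theorem intertwiner_conjTranspose {V : URep G m} {T : URep G n} {A : Matrix n m ℂ}
    (hA : ∀ g, (T g : Matrix n n ℂ) * A = A * (V g : Matrix m m ℂ)) (g : G) :
    (V g : Matrix m m ℂ) * Aᴴ = Aᴴ * (T g : Matrix n n ℂ) := by
  have h1 := congrArg Matrix.conjTranspose (hA g⁻¹)
  have hT : (T g⁻¹ : Matrix n n ℂ)ᴴ = T g := by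
    rw [map_inv, ← Matrix.star_eq_conjTranspose]
    change star (star (T g : Matrix n n ℂ)) = _
    rw [star_star]
  have hV : (V g⁻¹ : Matrix m m ℂ)ᴴ = V g := by
    rw [map_inv, ← Matrix.star_eq_conjTranspose]
    change star (star (V g : Matrix m m ℂ)) = _
    rw [star_star]
  rw [Matrix.conjTranspose_mul, Matrix.conjTranspose_mul, hT, hV] at h1
  exact h1.symm

/-- The isotypic component of an irreducible representation `V` in `T` is spanned by the ranges of
orthogonal isometric intertwiners, as many as the multiplicity of `V` in `T`. -/
theorem exists_orthonormal_intertwiners (V : URep G m) (T : URep G n)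
    (hV : V.toRep.IsIrreducible) :
    ∃ A : Fin (multiplicity V T) → Matrix n m ℂ,
      (∀ i g, (T g : Matrix n n ℂ) * A i = A i * (V g : Matrix m m ℂ)) ∧
      (∀ i i', (A i)ᴴ * A i' = if i = i' then 1 else 0) ∧
      ∀ B : Matrix n m ℂ, (∀ g, (T g : Matrix n n ℂ) * B = B * (V g : Matrix m m ℂ)) →
        ∃ c : Fin (multiplicity V T) → ℂ, B = ∑ i, c i • A i := by
  have hm := nonempty_of_irreducible hV
  have hm0 : (Fintype.card m : ℂ) ≠ 0 := by simp
  let b := (stdOrthonormalBasis ℂ (intertwinerSpace V T)).reindex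
    (finCongr (finrank_intertwinerSpace V T))
  -- For Frobenius-orthonormal intertwiners, `(M (b i))ᴴ * M (b i')` is scalar with trace 0 or 1, so
  -- rescaling by the square root of the dimension produces isometries.
  let r : ℂ := (Real.sqrt (Fintype.card m) : ℝ)
  have hr : r * r = Fintype.card m := by
    rw [← Complex.ofReal_mul, Real.mul_self_sqrt (by positivity)]
    simp
  have hr0 : r ≠ 0 := by
    intro h
    rw [h, zero_mul] at hr
    exact hm0 hr.symm
  have hrs : starRingEnd ℂ r = r := Complex.conj_ofReal _
  let M : EuclideanSpace ℂ (n × m) →ₗ[ℂ] Matrix n m ℂ :=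
    { toFun := fun v => Matrix.of fun a b => v (a, b)
      map_add' := fun _ _ => by ext; simp
      map_smul' := fun _ _ => by ext; simp }
  have hMb : ∀ i g, (T g : Matrix n n ℂ) * M (b i) = M (b i) * (V g : Matrix m m ℂ) :=
    fun i g => (b i).2 g
  have hMr : ∀ i g, (T g : Matrix n n ℂ) * (r • M (b i)) = (r • M (b i)) * (V g : Matrix m m ℂ) := by
    intro i g
    rw [Matrix.mul_smul, hMb, Matrix.smul_mul]
  refine ⟨fun i => r • M (b i), hMr, fun i i' => ?_, fun B hB => ?_⟩
  · have h1 : ((M (b i))ᴴ * M (b i')).trace = if i = i' then 1 else 0 := by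
      rw [← orthonormal_iff_ite.1 b.orthonormal i i', Submodule.coe_inner, PiLp.inner_apply,
        Fintype.sum_prod_type_right]
      simp [Matrix.trace, Matrix.mul_apply, M, mul_comm]
    have h2 := intertwiner_eq_smul_one hV ((r • M (b i))ᴴ * (r • M (b i'))) (by
      intro g
      rw [← Matrix.mul_assoc, intertwiner_conjTranspose (hMr i), Matrix.mul_assoc, hMr,
        Matrix.mul_assoc])
    rw [h2, Matrix.conjTranspose_smul, Matrix.smul_mul, Matrix.mul_smul, Matrix.trace_smul,
      Matrix.trace_smul, h1]
    split_ifs with h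
    · rw [smul_eq_mul, smul_eq_mul, mul_one, Complex.star_def, hrs, hr, div_self hm0, one_smul]
    · simp
  · let v : intertwinerSpace V T := ⟨WithLp.toLp 2 fun x => B x.1 x.2, hB⟩
    refine ⟨fun i => r⁻¹ * b.repr v i, ?_⟩
    have h1 : B = M (v : EuclideanSpace ℂ (n × m)) := rfl
    have h2 : (v : EuclideanSpace ℂ (n × m)) = ∑ i, b.repr v i • (b i : EuclideanSpace ℂ (n × m)) := by
      conv_lhs => rw [← b.sum_repr v]
      simp
    rw [h1, h2, map_sum]
    refine Finset.sum_congr rfl fun i _ => ?_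
    rw [map_smul, smul_smul, mul_right_comm, inv_mul_cancel₀ hr0, one_mul]

/-- Complete reducibility: a unitary representation is unitarily equivalent to the direct sum of
the irreducible representations it contains. -/
theorem exists_decomposition [TopologicalSpace G] {κ : Type*} [Fintype κ] {e : κ → ℕ}
    (V : (K : κ) → URep G (Fin (e K)))
    (irr : ∀ K, (V K).toRep.IsIrreducible)
    (ineq : ∀ K K', K ≠ K' → IsEmpty ((V K).toRep.Equiv (V K').toRep))
    (T : URep G n) (hT : Continuous T)
    (complete : ∀ (k : ℕ) (W : URep G (Fin k)), Continuous W → W.toRep.IsIrreducible →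
      Contained W T → ∃ K, Nonempty (W.toRep.Equiv (V K).toRep)) :
    ∃ A : (K : κ) → Fin (multiplicity (V K) T) → Matrix n (Fin (e K)) ℂ,
      (∀ K i g, (T g : Matrix n n ℂ) * A K i = A K i * (V K g : Matrix _ _ ℂ)) ∧
      (∀ K i i', (A K i)ᴴ * A K i' = if i = i' then 1 else 0) ∧
      ∑ K, ∑ i, A K i * (A K i)ᴴ = 1 := by
  choose A hA hAo hAs using fun K => exists_orthonormal_intertwiners (V K) T (irr K)
  refine ⟨A, hA, hAo, ?_⟩
  have hne : ∀ K K' i i', K ≠ K' → (A K i)ᴴ * A K' i' = 0 := by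
    intro K K' i i' h
    refine intertwiner_eq_zero (irr K') (irr K) (ineq K' K h.symm) _ fun g => ?_
    rw [← Matrix.mul_assoc, intertwiner_conjTranspose (hA K i), Matrix.mul_assoc, hA,
      Matrix.mul_assoc]
  set P : Matrix n n ℂ := ∑ K, ∑ i, A K i * (A K i)ᴴ with hP
  have hPA : ∀ K i, P * A K i = A K i := by
    intro K i
    rw [hP, Matrix.sum_mul, Finset.sum_eq_single K, Matrix.sum_mul, Finset.sum_eq_single i]
    · rw [Matrix.mul_assoc, hAo, if_pos rfl, Matrix.mul_one]
    · intro i' _ h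
      rw [Matrix.mul_assoc, hAo, if_neg h, Matrix.mul_zero]
    · simp
    · intro K' _ h
      rw [Matrix.sum_mul]
      refine Finset.sum_eq_zero fun i' _ => ?_
      rw [Matrix.mul_assoc, hne K' K i' i h, Matrix.mul_zero]
    · simp
  have hPT : ∀ g, (T g : Matrix n n ℂ) * P = P * (T g : Matrix n n ℂ) := by
    intro g
    simp only [hP, Matrix.mul_sum, Matrix.sum_mul]
    refine Finset.sum_congr rfl fun K _ => Finset.sum_congr rfl fun i _ => ?_
    rw [← Matrix.mul_assoc, hA, Matrix.mul_assoc, intertwiner_conjTranspose (hA K i),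
      Matrix.mul_assoc]
  have hPP : P * P = P := by
    calc P * P = P * ∑ K, ∑ i, A K i * (A K i)ᴴ := by rw [← hP]
      _ = ∑ K, ∑ i, P * A K i * (A K i)ᴴ := by simp only [Matrix.mul_sum, ← Matrix.mul_assoc]
      _ = P := by simp only [hPA]; exact hP.symm
  by_contra hne1
  -- `P` is a projection commuting with `T`. If it is not the identity, its kernel is a nonzero
  -- subrepresentation and contains an irreducible.
  let S : Subrepresentation T.toRep :=
    { toSubmodule := LinearMap.ker (Matrix.toLin' P)
      apply_mem_toSubmodule := by
        intro g v hv
        rw [LinearMap.mem_ker, Matrix.toLin'_apply] at hv ⊢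
        rw [URep.toRep_apply, Matrix.mulVec_mulVec, ← hPT, ← Matrix.mulVec_mulVec, hv,
          Matrix.mulVec_zero] }
  have hS : S ≠ ⊥ := by
    intro h
    apply hne1
    refine Matrix.toLin'.injective (LinearMap.ext fun v => ?_)
    have hv : v - P *ᵥ v ∈ S := by
      change Matrix.toLin' P _ = 0
      rw [Matrix.toLin'_apply, Matrix.mulVec_sub, Matrix.mulVec_mulVec, hPP, sub_self]
    rw [h] at hv
    have hv0 : v - P *ᵥ v = 0 := hv
    rw [Matrix.toLin'_apply, Matrix.toLin'_one, LinearMap.id_apply]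
    exact (sub_eq_zero.1 hv0).symm
  obtain ⟨k, W, B, hW, hWi, hB, hBT, hBS⟩ := exists_irreducible_le hT S hS
  have hPB : P * B = 0 := by
    refine Matrix.toLin'.injective (LinearMap.ext fun v => ?_)
    rw [Matrix.toLin'_apply]
    have h : Matrix.toLin' P (B *ᵥ v) = 0 := hBS v
    simpa using h
  obtain ⟨K, ⟨φ⟩⟩ := complete k W hW hWi ⟨intertwinerOfMatrix B hBT, fun v w h => by
    rw [intertwinerOfMatrix_apply, intertwinerOfMatrix_apply] at h
    have := congrArg (Bᴴ *ᵥ ·) h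
    simpa [Matrix.mulVec_mulVec, hB] using this⟩
  -- Precomposing `B` with the equivalence `C` from `V K` gives an intertwiner in the span of the `A
  -- K i`, hence fixed by `P`, while `P * B = 0`. Thus `C = 0`, impossible for an equivalence.
  have hC := intertwiner_toMatrix' φ.symm.toIntertwiningMap
  set C := LinearMap.toMatrix' φ.symm.toIntertwiningMap.toLinearMap
  obtain ⟨c, hc⟩ := hAs K (B * C) (fun g => by
    rw [← Matrix.mul_assoc, hBT, Matrix.mul_assoc, hC, Matrix.mul_assoc])
  have hBC : B * C = 0 := by
    have h1 : P * (B * C) = B * C := by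
      rw [hc, Matrix.mul_sum]
      refine Finset.sum_congr rfl fun i _ => ?_
      rw [Matrix.mul_smul, hPA]
    rw [← h1, ← Matrix.mul_assoc, hPB, Matrix.zero_mul]
  have hC0 : C = 0 := by
    rw [← Matrix.one_mul C, ← hB, Matrix.mul_assoc, hBC, Matrix.mul_zero]
  have hφ : φ.symm.toIntertwiningMap.toLinearMap = 0 := by
    exact (LinearEquiv.map_eq_zero_iff _).1 hC0
  obtain ⟨x⟩ := nonempty_of_irreducible (irr K)
  have h1 : φ.symm (Pi.single x 1) = 0 := congrArg (fun f => f (Pi.single x 1)) hφ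
  have h2 : (Pi.single x 1 : Fin (e K) → ℂ) = 0 := by
    rw [← φ.apply_symm_apply (Pi.single x 1), h1, map_zero]
  simpa using congrFun h2 x

end Decomposition

/-! ### The Frobenius norm -/

section Frobenius

variable {m n l : Type*} [Fintype m] [Fintype n] [Fintype l]

/-- The squared Frobenius norm. -/
def frobSq (A : Matrix m n ℂ) : ℝ := ∑ a, ∑ b, ‖A a b‖ ^ 2

theorem frobSq_nonneg (A : Matrix m n ℂ) : 0 ≤ frobSq A := by
  unfold frobSq; positivity

theorem ofReal_frobSq (A : Matrix m n ℂ) : (frobSq A : ℂ) = (A * Aᴴ).trace := by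
  simp only [frobSq, Matrix.trace, Matrix.diag, Matrix.mul_apply, Matrix.conjTranspose_apply]
  push_cast
  simp only [Complex.star_def, Complex.mul_conj, Complex.normSq_eq_norm_sq, Complex.ofReal_pow]

theorem ofReal_frobSq' (A : Matrix m n ℂ) : (frobSq A : ℂ) = (Aᴴ * A).trace := by
  rw [ofReal_frobSq, Matrix.trace_mul_comm]

/-- Pythagoras for the projection `A * Aᴴ` and its complement. -/
theorem frobSq_mul_isometry_le [DecidableEq n] [DecidableEq l] (M : Matrix m n ℂ)
    (A : Matrix n l ℂ) (hA : Aᴴ * A = 1) : frobSq (M * A) ≤ frobSq M := by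
  have h : frobSq M = frobSq (M * A) + frobSq (M * (1 - A * Aᴴ)) := by
    have : (frobSq M : ℂ) = frobSq (M * A) + frobSq (M * (1 - A * Aᴴ)) := by
      rw [ofReal_frobSq, ofReal_frobSq, ofReal_frobSq, ← Matrix.trace_add]
      have hp : (1 - A * Aᴴ) * (1 - A * Aᴴ)ᴴ = 1 - A * Aᴴ := by
        have h1 : A * Aᴴ * (A * Aᴴ) = A * Aᴴ := by
          rw [Matrix.mul_assoc, ← Matrix.mul_assoc Aᴴ, hA, Matrix.one_mul]
        rw [Matrix.conjTranspose_sub, Matrix.conjTranspose_mul, Matrix.conjTranspose_conjTranspose,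
          Matrix.conjTranspose_one, mul_sub, sub_mul, sub_mul, h1]
        simp
      rw [Matrix.conjTranspose_mul M (1 - A * Aᴴ), Matrix.mul_assoc M (1 - A * Aᴴ),
        ← Matrix.mul_assoc (1 - A * Aᴴ), hp, Matrix.conjTranspose_mul, Matrix.mul_assoc M A,
        ← Matrix.mul_add, ← Matrix.mul_assoc A, ← Matrix.add_mul, add_sub_cancel, Matrix.one_mul]
    exact_mod_cast this
  rw [h]
  linarith [frobSq_nonneg (M * (1 - A * Aᴴ))]

end Frobenius

/-! ### Parseval's identity for matrix entries -/

section OrthogonalExpansion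

variable {G : Type*} [Group G] [TopologicalSpace G] [IsTopologicalGroup G]
    [CompactSpace G] [MeasurableSpace G] [BorelSpace G] (μ : Measure G) [μ.IsHaarMeasure]
    [IsProbabilityMeasure μ]
    {κ : Type*} {e : κ → ℕ} {V : (K : κ) → URep G (Fin (e K))}

/-- The orthogonality relations for the matrix entries of inequivalent irreducibles. -/
theorem integral_entries [DecidableEq κ] (cont : ∀ K, Continuous (V K))
    (irr : ∀ K, (V K).toRep.IsIrreducible)
    (ineq : ∀ K K', K ≠ K' → IsEmpty ((V K).toRep.Equiv (V K').toRep)) (x y : Mem e) :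
    ∫ g, (V x.1 g : Matrix _ _ ℂ) x.2.1 x.2.2 *
      starRingEnd ℂ ((V y.1 g : Matrix _ _ ℂ) y.2.1 y.2.2) ∂μ
      = if x = y then 1 / (e x.1 : ℂ) else 0 := by
  obtain ⟨K, a, b⟩ := x
  obtain ⟨L, c, f⟩ := y
  by_cases h : K = L
  · subst h
    rw [integral_entry_mul_conj_entry μ (cont K) (irr K)]
    simp
  · rw [integral_entry_mul_conj_entry_of_inequivalent μ (cont L) (cont K) (irr L) (irr K)
      (ineq L K (Ne.symm h))]
    simp [h]

theorem integral_norm_sq_sum_entries [Fintype κ] (cont : ∀ K, Continuous (V K))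
    (irr : ∀ K, (V K).toRep.IsIrreducible)
    (ineq : ∀ K K', K ≠ K' → IsEmpty ((V K).toRep.Equiv (V K').toRep)) (c : Mem e → ℂ) :
    ∫ g, ‖∑ x : Mem e, c x * (V x.1 g : Matrix _ _ ℂ) x.2.1 x.2.2‖ ^ 2 ∂μ
      = ∑ x : Mem e, ‖c x‖ ^ 2 / e x.1 := by
  classical
  have hc : ∀ x : Mem e, Continuous fun g => (V x.1 g : Matrix _ _ ℂ) x.2.1 x.2.2 :=
    fun x => URep.continuous_apply (cont x.1) _ _
  apply Complex.ofReal_injective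
  rw [← integral_complex_ofReal]
  have h : ∀ g, ((‖∑ x : Mem e, c x * (V x.1 g : Matrix _ _ ℂ) x.2.1 x.2.2‖ ^ 2 : ℝ) : ℂ)
      = ∑ x : Mem e, ∑ y : Mem e, c x * starRingEnd ℂ (c y) *
        ((V x.1 g : Matrix _ _ ℂ) x.2.1 x.2.2 *
          starRingEnd ℂ ((V y.1 g : Matrix _ _ ℂ) y.2.1 y.2.2)) := by
    intro g
    rw [← Complex.normSq_eq_norm_sq, ← Complex.mul_conj, map_sum, Finset.sum_mul_sum]
    refine Finset.sum_congr rfl fun x _ => Finset.sum_congr rfl fun y _ => ?_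
    rw [map_mul]
    ring
  simp_rw [h]
  rw [integral_finsetSum _ fun x _ => integrable_of_continuous μ (by fun_prop)]
  push_cast
  refine Finset.sum_congr rfl fun x _ => ?_
  rw [integral_finsetSum _ fun y _ => integrable_of_continuous μ (by fun_prop)]
  simp_rw [integral_const_mul, integral_entries μ cont irr ineq]
  rw [Finset.sum_eq_single x (fun y _ hy => by simp [Ne.symm hy]) (by simp), if_pos rfl,
    Complex.mul_conj, Complex.normSq_eq_norm_sq]
  push_cast
  ring

/-- Parseval in coordinate-free form: entry `(b, a)` of `Y K` is the coefficient of entry `(a, b)`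
of `V K`, and each such entry has squared `L²` norm `1 / e K`. -/
theorem integral_norm_sq_sum_trace [Fintype κ] (cont : ∀ K, Continuous (V K))
    (irr : ∀ K, (V K).toRep.IsIrreducible)
    (ineq : ∀ K K', K ≠ K' → IsEmpty ((V K).toRep.Equiv (V K').toRep))
    (Y : (K : κ) → Matrix (Fin (e K)) (Fin (e K)) ℂ) :
    ∫ g, ‖∑ K, (Y K * (V K g : Matrix _ _ ℂ)).trace‖ ^ 2 ∂μ = ∑ K, frobSq (Y K) / e K := by
  have h := integral_norm_sq_sum_entries μ cont irr ineq fun x => Y x.1 x.2.2 x.2.1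
  simp only [Fintype.sum_sigma, Fintype.sum_prod_type] at h
  have h1 : ∀ g, ∑ K, (Y K * (V K g : Matrix _ _ ℂ)).trace
      = ∑ K, ∑ a, ∑ b, Y K b a * (V K g : Matrix _ _ ℂ) a b := by
    intro g
    refine Finset.sum_congr rfl fun K _ => ?_
    simp only [Matrix.trace, Matrix.diag, Matrix.mul_apply]
    rw [Finset.sum_comm]
  simp_rw [h1, h]
  refine Finset.sum_congr rfl fun K _ => ?_
  rw [frobSq, Finset.sum_comm]
  simp only [Finset.sum_div]

end OrthogonalExpansion

section Decomposition

/-- Insert the resolution of the identity to the right of `T g` and move `T g` through the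
intertwiners. -/
theorem eq_sum_of_decomposition {G : Type*} [Group G] {κ : Type*} [Fintype κ] {e : κ → ℕ}
    {V : (K : κ) → URep G (Fin (e K))} {m : Type*} [Fintype m] [DecidableEq m] {T : URep G m}
    {A : (K : κ) → Fin (multiplicity (V K) T) → Matrix m (Fin (e K)) ℂ}
    (hA : ∀ K i g, (T g : Matrix m m ℂ) * A K i = A K i * (V K g : Matrix _ _ ℂ))
    (hA1 : ∑ K, ∑ i, A K i * (A K i)ᴴ = 1) (g : G) :
    (T g : Matrix m m ℂ) = ∑ K, ∑ i, A K i * (V K g : Matrix (Fin (e K)) (Fin (e K)) ℂ) * (A K i)ᴴ := by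
  rw [← Matrix.mul_one (T g : Matrix m m ℂ), ← hA1]
  simp only [Matrix.mul_sum, ← Matrix.mul_assoc, hA]
  rfl

end Decomposition

/-! ### The Cauchy–Schwarz bound -/

section Bound

variable {G : Type*} [Group G] [TopologicalSpace G] [IsTopologicalGroup G]
    [CompactSpace G] [MeasurableSpace G] [BorelSpace G] (μ : Measure G) [μ.IsHaarMeasure]
    [IsProbabilityMeasure μ]
    {κ : Type*} [Fintype κ] {e : κ → ℕ} {V : (K : κ) → URep G (Fin (e K))}
    {ι : Type*} [Fintype ι] {n : ι → Type*} [∀ j, Fintype (n j)] [∀ j, DecidableEq (n j)]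

/-- A bound on the `L²` norm of a combination of matrix entries of the representations `T j`, by a
quadratic form that acts on one side only of the coefficient matrices. -/
theorem integral_norm_sq_le (cont : ∀ K, Continuous (V K))
    (irr : ∀ K, (V K).toRep.IsIrreducible)
    (ineq : ∀ K K', K ≠ K' → IsEmpty ((V K).toRep.Equiv (V K').toRep))
    (T : (j : ι) → URep G (n j))
    (A : (j : ι) → (K : κ) → Fin (multiplicity (V K) (T j)) → Matrix (n j) (Fin (e K)) ℂ)
    (hA : ∀ j K i g, (T j g : Matrix _ _ ℂ) * A j K i = A j K i * (V K g : Matrix _ _ ℂ))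
    (hAo : ∀ j K i, (A j K i)ᴴ * A j K i = 1)
    (hA1 : ∀ j, ∑ K, ∑ i, A j K i * (A j K i)ᴴ = 1)
    (p : ι → ℝ) (hp : ∀ j, 0 ≤ p j) (δ : ι → ℝ) (hδ : ∀ j, 0 ≤ δ j)
    (w : (j : ι) → Matrix (n j) (n j) ℂ) :
    ∫ g, ‖∑ j, (Real.sqrt (p j / δ j) : ℂ) * (w j * (T j g : Matrix _ _ ℂ)).trace‖ ^ 2 ∂μ
      ≤ ∑ K, (∑ j, (multiplicity (V K) (T j) : ℝ) * Real.sqrt (p j)) / e K *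
        ∑ j, Real.sqrt (p j) / δ j * ∑ i, frobSq ((A j K i)ᴴ * w j) := by
  -- The coefficient of `V K`: diagonal blocks of the `w j`, added over every copy of `V K` in every
  -- `T j`.
  let Y : (K : κ) → Matrix (Fin (e K)) (Fin (e K)) ℂ := fun K =>
    ∑ j, ∑ i, (Real.sqrt (p j / δ j) : ℂ) • ((A j K i)ᴴ * w j * A j K i)
  have hY : ∀ g, ∑ j, (Real.sqrt (p j / δ j) : ℂ) * (w j * (T j g : Matrix _ _ ℂ)).trace
      = ∑ K, (Y K * (V K g : Matrix _ _ ℂ)).trace := by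
    intro g
    simp only [Y, Matrix.sum_mul, Matrix.trace_sum]
    rw [Finset.sum_comm]
    refine Finset.sum_congr rfl fun j _ => ?_
    rw [eq_sum_of_decomposition (hA j) (hA1 j) g]
    simp only [Matrix.trace_sum, Finset.mul_sum]
    refine Finset.sum_congr rfl fun K _ => Finset.sum_congr rfl fun i _ => ?_
    rw [Matrix.smul_mul, Matrix.trace_smul, smul_eq_mul, ← Matrix.mul_assoc, Matrix.trace_mul_comm]
    simp only [Matrix.mul_assoc]
  simp_rw [hY]
  rw [integral_norm_sq_sum_trace μ cont irr ineq]
  refine Finset.sum_le_sum fun K _ => ?_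
  rw [div_mul_eq_mul_div]
  refine div_le_div_of_nonneg_right ?_ (by positivity)
  have hentry : ∀ a b, ‖Y K a b‖ ^ 2
      ≤ (∑ j, (multiplicity (V K) (T j) : ℝ) * Real.sqrt (p j)) *
        ∑ j, ∑ i, Real.sqrt (p j) / δ j * ‖((A j K i)ᴴ * w j * A j K i) a b‖ ^ 2 := by
    intro a b
    have h1 : ‖Y K a b‖ ≤ ∑ x : (j : ι) × Fin (multiplicity (V K) (T j)),
        Real.sqrt (p x.1 / δ x.1) * ‖((A x.1 K x.2)ᴴ * w x.1 * A x.1 K x.2) a b‖ := by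
      rw [Fintype.sum_sigma]
      simp only [Y, Matrix.sum_apply, Matrix.smul_apply, smul_eq_mul]
      refine (norm_sum_le _ _).trans (Finset.sum_le_sum fun j _ => ?_)
      refine (norm_sum_le _ _).trans (Finset.sum_le_sum fun i _ => ?_)
      rw [norm_mul, Complex.norm_real, Real.norm_of_nonneg (Real.sqrt_nonneg _)]
    -- Cauchy–Schwarz over the pairs `(j, i)`, splitting `p j / δ j` as `√p_j` times `√p_j / δ j`.
    -- The first factor then sums to the multiplicity-weighted total of the `√p_j`.
    have h2 := Finset.sum_sq_le_sum_mul_sum_of_sq_le_mul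
      (Finset.univ : Finset ((j : ι) × Fin (multiplicity (V K) (T j))))
      (r := fun x => Real.sqrt (p x.1 / δ x.1) * ‖((A x.1 K x.2)ᴴ * w x.1 * A x.1 K x.2) a b‖)
      (f := fun x => Real.sqrt (p x.1))
      (g := fun x => Real.sqrt (p x.1) / δ x.1 *
        ‖((A x.1 K x.2)ᴴ * w x.1 * A x.1 K x.2) a b‖ ^ 2)
      (fun x _ => Real.sqrt_nonneg _)
      (fun x _ => mul_nonneg (div_nonneg (Real.sqrt_nonneg _) (hδ _)) (sq_nonneg _))
      (fun x _ => by
        rw [mul_pow, Real.sq_sqrt (div_nonneg (hp _) (hδ _)), ← mul_assoc, ← mul_div_assoc,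
          Real.mul_self_sqrt (hp _)])
    refine (pow_le_pow_left₀ (norm_nonneg _) h1 2).trans (h2.trans_eq ?_)
    rw [Fintype.sum_sigma, Fintype.sum_sigma]
    simp
  have hs : 0 ≤ ∑ j, (multiplicity (V K) (T j) : ℝ) * Real.sqrt (p j) := by positivity
  calc frobSq (Y K) ≤ ∑ a, ∑ b, (∑ j, (multiplicity (V K) (T j) : ℝ) * Real.sqrt (p j)) *
        ∑ j, ∑ i, Real.sqrt (p j) / δ j * ‖((A j K i)ᴴ * w j * A j K i) a b‖ ^ 2 :=
      Finset.sum_le_sum fun a _ => Finset.sum_le_sum fun b _ => hentry a b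
    _ = (∑ j, (multiplicity (V K) (T j) : ℝ) * Real.sqrt (p j)) *
        ∑ j, Real.sqrt (p j) / δ j * ∑ i, frobSq ((A j K i)ᴴ * w j * A j K i) := by
      simp only [frobSq, Finset.mul_sum]
      simp only [← Fintype.sum_prod_type' (α₁ := Fin (e K)) (α₂ := Fin (e K))]
      rw [Finset.sum_comm]
      refine Finset.sum_congr rfl fun j _ => ?_
      rw [Finset.sum_comm]
    _ ≤ _ := by
      refine mul_le_mul_of_nonneg_left (Finset.sum_le_sum fun j _ => ?_) hs
      refine mul_le_mul_of_nonneg_left (Finset.sum_le_sum fun i _ => ?_)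
        (div_nonneg (Real.sqrt_nonneg _) (hδ _))
      -- Only the left isometry is kept: the column index of `w j` must stay free for the partial
      -- trace condition to apply later.
      exact frobSq_mul_isometry_le _ _ (hAo j K i)

end Bound

/-! ### Nonzero multiplicities and the sets `P_KK` -/

section Containment

variable {G : Type*} [Group G] {d : ℕ} (U : URep G (Fin d))
  {ι : Type*} {dim : ι → ℕ} (W : (j : ι) → URep G (Fin (dim j)))
  {κ : Type*} {e : κ → ℕ} (V : (K : κ) → URep G (Fin (e K)))

/-- An isometric intertwiner `B` from `V K` to `U ⊗ U_j*` gives the isometry `B ⊗ conj B` for `G ×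
G`; the permutation `σ` only reorders the four tensor factors of the target. -/
theorem mem_blockSet_of_multiplicity_ne_zero {K : κ} {j : ι} (hK : (V K).toRep.IsIrreducible)
    (h : multiplicity (V K) (U.tensor (W j).conj) ≠ 0) : j ∈ blockSet U W V K K := by
  obtain ⟨A, hA, hAo, -⟩ := exists_orthonormal_intertwiners (V K) (U.tensor (W j).conj) hK
  let i : Fin (multiplicity (V K) (U.tensor (W j).conj)) := ⟨0, Nat.pos_of_ne_zero h⟩
  let B : Matrix (Fin d × Fin (dim j)) (Fin (e K)) ℂ := A i
  have hB : Bᴴ * B = 1 := by rw [hAo i i, if_pos rfl]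
  let σ : (Fin d × Fin d) × (Fin (dim j) × Fin (dim j))
      ≃ (Fin d × Fin (dim j)) × (Fin d × Fin (dim j)) := Equiv.prodProdProdComm _ _ _ _
  let N : Matrix ((Fin d × Fin d) × (Fin (dim j) × Fin (dim j))) (Fin (e K) × Fin (e K)) ℂ :=
    (B ⊗ₖ B.map (starRingEnd ℂ)).submatrix σ id
  have hN : Nᴴ * N = 1 := by
    have h1 : (B.map (starRingEnd ℂ))ᴴ * B.map (starRingEnd ℂ) = 1 := by
      have := congrArg (fun M : Matrix _ _ ℂ => M.map (starRingEnd ℂ)) hB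
      simp only [Matrix.map_mul] at this
      rw [Matrix.map_one _ (map_zero _) (map_one _)] at this
      rw [← this]
      congr 1
    simp only [N]
    rw [Matrix.conjTranspose_submatrix, Matrix.submatrix_mul_equiv, Matrix.conjTranspose_kronecker,
      ← Matrix.mul_kronecker_mul, hB, h1]
    simp
  refine ⟨intertwinerOfMatrix N fun g => ?_, fun v w hvw => ?_⟩
  · have hT : ((URep.tensor
        (URep.tensor (U.comp (MonoidHom.fst G G)) (URep.conj (U.comp (MonoidHom.snd G G))))
        (URep.tensor (URep.conj ((W j).comp (MonoidHom.fst G G)))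
          ((W j).comp (MonoidHom.snd G G))) g : Matrix.unitaryGroup _ ℂ) : Matrix _ _ ℂ)
        = (((U.tensor (W j).conj) g.1 : Matrix _ _ ℂ) ⊗ₖ
          ((U.tensor (W j).conj) g.2 : Matrix _ _ ℂ).map (starRingEnd ℂ)).submatrix σ σ := by
      ext x y
      simp [URep.tensor, URep.conj, σ]
      ring
    have hV : ((URep.tensor ((V K).comp (MonoidHom.fst G G))
        (URep.conj ((V K).comp (MonoidHom.snd G G))) g : Matrix.unitaryGroup _ ℂ) : Matrix _ _ ℂ)
        = (V K g.1 : Matrix (Fin (e K)) (Fin (e K)) ℂ) ⊗ₖ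
          (V K g.2 : Matrix (Fin (e K)) (Fin (e K)) ℂ).map (starRingEnd ℂ) := rfl
    rw [hT, hV]
    simp only [N]
    rw [Matrix.submatrix_mul_equiv, ← Matrix.mul_kronecker_mul, ← Matrix.map_mul]
    simp only [B]
    rw [hA, hA, Matrix.map_mul, Matrix.mul_kronecker_mul]
    rfl
  · rw [intertwinerOfMatrix_apply, intertwinerOfMatrix_apply] at hvw
    have := congrArg (Nᴴ *ᵥ ·) hvw
    simpa [Matrix.mulVec_mulVec, hN] using this

/-- Every `j` with nonzero multiplicity lies in `P_KK`, so restricting the sum to `P_KK` drops only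
zero terms. -/
theorem estValue_eq [Fintype ι] [Fintype κ] (irr : ∀ K, (V K).toRep.IsIrreducible) (p : ι → ℝ) :
    estValue U W V p = (1 / (d : ℝ) ^ 2) *
      ∑ K, (∑ j, (multiplicity (V K) (U.tensor (W j).conj) : ℝ) * Real.sqrt (p j)) ^ 2 := by
  classical
  rw [estValue, Finset.mul_sum]
  refine Finset.sum_congr rfl fun K _ => ?_
  rw [Finset.sum_filter_of_ne, one_div_mul_eq_div]
  intro j _ hj
  refine mem_blockSet_of_multiplicity_ne_zero U W V (irr K) fun h => hj ?_
  rw [h]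
  simp

end Containment

/-! ### Overlaps of the memory states with `η` -/

section States

variable {G : Type*} [Group G] {ι : Type*} [Fintype ι] [DecidableEq ι] {dim : ι → ℕ}
  (W : (j : ι) → URep G (Fin (dim j))) (p : ι → ℝ)

theorem memoryState_apply (g : G) (x : Mem dim) :
    memoryState W p g x
      = (Real.sqrt (p x.1 / dim x.1) : ℂ) * (W x.1 g : Matrix _ _ ℂ) x.2.1 x.2.2 := by
  obtain ⟨j, b, c⟩ := x
  simp only [memoryState, Matrix.mulVec, dotProduct, storage, Fintype.sum_sigma]
  rw [Finset.sum_eq_single j]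
  · simp [Matrix.blockDiagonal'_apply, Fintype.sum_prod_type, inputState, dket, Matrix.one_apply,
      mul_comm]
  · intro k _ hk
    refine Finset.sum_eq_zero fun y _ => ?_
    rw [Matrix.blockDiagonal'_apply_ne _ _ _ (Ne.symm hk), zero_mul]
  · simp

theorem star_dotProduct_dket_eq_trace {m n : Type*} [Fintype m] [Fintype n] (A B : Matrix m n ℂ) :
    star (dket A) ⬝ᵥ dket B = (Aᴴ * B).trace := by
  simp only [dotProduct, Matrix.trace, Matrix.diag, Matrix.mul_apply, Fintype.sum_prod_type, dket,
    Pi.star_apply, Matrix.conjTranspose_apply]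
  rw [Finset.sum_comm]

theorem URep.conjTranspose_mul {n : Type*} [Fintype n] [DecidableEq n] (T : URep G n) (g h : G) :
    (T g : Matrix n n ℂ)ᴴ * (T h : Matrix n n ℂ) = (T (g⁻¹ * h) : Matrix n n ℂ) := by
  rw [map_mul, map_inv]
  rfl

/-- The weights `√(p_j/d_j)` and `√d_j` multiply to `√p_j`, and the overlap depends on `g⁻¹h` alone.
-/
theorem star_memoryState_dotProduct_etaVec (hd : ∀ j, 0 < dim j) (g h : G) :
    star (memoryState W p g) ⬝ᵥ etaVec W h
      = ∑ j, (Real.sqrt (p j) : ℂ) * (W j (g⁻¹ * h) : Matrix (Fin (dim j)) (Fin (dim j)) ℂ).trace := by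
  simp only [dotProduct, Fintype.sum_sigma, Pi.star_apply, memoryState_apply, etaVec]
  refine Finset.sum_congr rfl fun j _ => ?_
  have hj : (0 : ℝ) < dim j := by exact_mod_cast hd j
  have h1 : (Real.sqrt (p j / dim j) : ℂ) * (Real.sqrt (dim j) : ℂ) = Real.sqrt (p j) := by
    rw [← Complex.ofReal_mul, ← Real.sqrt_mul' _ hj.le, div_mul_cancel₀ _ hj.ne']
  rw [← URep.conjTranspose_mul, ← star_dotProduct_dket_eq_trace, dotProduct, Finset.mul_sum]
  refine Finset.sum_congr rfl fun x _ => ?_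
  rw [← h1, star_mul', Complex.star_def, Complex.conj_ofReal]
  simp only [dket, Pi.star_apply, Complex.star_def]
  ring

end States

/-! ### The optimal value and the common upper bound -/

section Main

variable {G : Type*} [Group G] [TopologicalSpace G] [IsTopologicalGroup G]
    [CompactSpace G] [MeasurableSpace G] [BorelSpace G] (μ : Measure G) [μ.IsHaarMeasure]
    [IsProbabilityMeasure μ] {d : ℕ} {U : URep G (Fin d)}
    {κ : Type*} [Fintype κ] {e : κ → ℕ} {V : (K : κ) → URep G (Fin (e K))}
    {ι : Type*} [Fintype ι] {dim : ι → ℕ} {W : (j : ι) → URep G (Fin (dim j))}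

theorem URep.continuous_tensor_conj {G : Type*} [Group G] [TopologicalSpace G] {m n : Type*}
    [Fintype m] [DecidableEq m] [Fintype n] [DecidableEq n] {U : URep G m} {W : URep G n}
    (hU : Continuous U) (hW : Continuous W) : Continuous (U.tensor W.conj) := by
  refine Continuous.subtype_mk (continuous_matrix fun x y => ?_) _
  have := URep.continuous_apply hU
  have := URep.continuous_apply hW
  simp only [URep.conj, Matrix.kroneckerMap_apply]
  change Continuous fun g => (U g : Matrix m m ℂ) x.1 y.1 *
    starRingEnd ℂ ((W g : Matrix n n ℂ) x.2 y.2)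
  fun_prop

theorem exists_tensor_decomposition {G : Type*} [Group G] [TopologicalSpace G] {d : ℕ}
    {U : URep G (Fin d)} {κ : Type*} [Fintype κ] {e : κ → ℕ} {V : (K : κ) → URep G (Fin (e K))}
    {ι : Type*} {dim : ι → ℕ} {W : (j : ι) → URep G (Fin (dim j))} (hU : Continuous U) (contW : ∀ j, Continuous (W j))
    (hV : IsIrrList V (fun j : ι => U.tensor (W j).conj)) (j : ι) :
    ∃ A : (K : κ) → Fin (multiplicity (V K) (U.tensor (W j).conj)) →
        Matrix (Fin d × Fin (dim j)) (Fin (e K)) ℂ,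
      (∀ K i g, (U.tensor (W j).conj g : Matrix (Fin d × Fin (dim j)) (Fin d × Fin (dim j)) ℂ) * A K i = A K i * (V K g : Matrix (Fin (e K)) (Fin (e K)) ℂ)) ∧
      (∀ K i i', (A K i)ᴴ * A K i' = if i = i' then 1 else 0) ∧
      ∑ K, ∑ i, A K i * (A K i)ᴴ = 1 :=
  exists_decomposition V hV.irreducible hV.inequivalent _
    (URep.continuous_tensor_conj hU (contW j))
    fun k W' h1 h2 h3 => hV.complete k W' h1 h2 ⟨j, h3⟩

/-- The squared norm of a combination of characters, integrated over the group. -/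
theorem integral_norm_sq_trace_mul (hU : Continuous U) (contW : ∀ j, Continuous (W j))
    (hV : IsIrrList V (fun j : ι => U.tensor (W j).conj))
    (p : ι → ℝ) :
    ∫ g, (‖(U g : Matrix (Fin d) (Fin d) ℂ).trace‖ *
      ‖∑ j, (Real.sqrt (p j) : ℂ) * (W j g : Matrix (Fin (dim j)) (Fin (dim j)) ℂ).trace‖) ^ 2 ∂μ
      = ∑ K, (∑ j, (multiplicity (V K) (U.tensor (W j).conj) : ℝ) * Real.sqrt (p j)) ^ 2 := by
  choose A hA hAo hA1 using exists_tensor_decomposition hU contW hV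
  let s : κ → ℝ := fun K => ∑ j, (multiplicity (V K) (U.tensor (W j).conj) : ℝ) * Real.sqrt (p j)
  -- Characters: `χ_U` times the conjugate of `χ_j` is the character of `U ⊗ U_j*`, which decomposes
  -- with the multiplicities as coefficients.
  have htr : ∀ j g, (U g : Matrix (Fin d) (Fin d) ℂ).trace *
      starRingEnd ℂ (W j g : Matrix (Fin (dim j)) (Fin (dim j)) ℂ).trace = ∑ K,
        (multiplicity (V K) (U.tensor (W j).conj) : ℂ) * (V K g : Matrix (Fin (e K)) (Fin (e K)) ℂ).trace := by
    intro j g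
    have h1 : (U.tensor (W j).conj g : Matrix (Fin d × Fin (dim j)) (Fin d × Fin (dim j)) ℂ).trace
        = (U g : Matrix (Fin d) (Fin d) ℂ).trace * starRingEnd ℂ (W j g : Matrix (Fin (dim j)) (Fin (dim j)) ℂ).trace := by
      change ((U g : Matrix (Fin d) (Fin d) ℂ) ⊗ₖ
        (W j g : Matrix (Fin (dim j)) (Fin (dim j)) ℂ).map (starRingEnd ℂ)).trace = _
      rw [Matrix.trace_kronecker]
      simp [Matrix.trace]
    rw [← h1, eq_sum_of_decomposition (hA j) (hA1 j) g, Matrix.trace_sum]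
    refine Finset.sum_congr rfl fun K _ => ?_
    rw [Matrix.trace_sum]
    have : ∀ i, (A j K i * (V K g : Matrix (Fin (e K)) (Fin (e K)) ℂ) * (A j K i)ᴴ).trace
        = (V K g : Matrix (Fin (e K)) (Fin (e K)) ℂ).trace := by
      intro i
      rw [Matrix.trace_mul_comm, ← Matrix.mul_assoc, hAo j K i i, if_pos rfl, Matrix.one_mul]
    simp [this]
  have h : ∀ g, (‖(U g : Matrix (Fin d) (Fin d) ℂ).trace‖ *
      ‖∑ j, (Real.sqrt (p j) : ℂ) * (W j g : Matrix (Fin (dim j)) (Fin (dim j)) ℂ).trace‖) ^ 2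
      = ‖∑ K, (((s K : ℂ) • (1 : Matrix (Fin (e K)) (Fin (e K)) ℂ)) *
        (V K g : Matrix (Fin (e K)) (Fin (e K)) ℂ)).trace‖ ^ 2 := by
    intro g
    -- Conjugating the second factor is free under the norm and makes characters of `U ⊗ U_j*`
    -- appear.
    rw [← Complex.norm_conj (∑ j, _), ← norm_mul, map_sum, Finset.mul_sum]
    congr 2
    simp only [map_mul, Complex.conj_ofReal, mul_left_comm, htr, Finset.mul_sum, s,
      Matrix.smul_mul, Matrix.one_mul, Matrix.trace_smul, smul_eq_mul]
    rw [Finset.sum_comm]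
    refine Finset.sum_congr rfl fun K _ => ?_
    push_cast
    rw [Finset.sum_mul]
    refine Finset.sum_congr rfl fun j _ => ?_
    ring
  simp_rw [h]
  rw [integral_norm_sq_sum_trace μ hV.continuous hV.irreducible hV.inequivalent]
  refine Finset.sum_congr rfl fun K _ => ?_
  have := nonempty_of_irreducible (hV.irreducible K)
  have he : (e K : ℝ) ≠ 0 := by
    have := Fintype.card_ne_zero (α := Fin (e K))
    rw [Fintype.card_fin] at this
    exact_mod_cast this
  rw [div_eq_iff he]
  simp only [frobSq, Matrix.smul_apply, Matrix.one_apply, smul_eq_mul, mul_ite, mul_one, mul_zero,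
    apply_ite norm, norm_zero, ite_pow, Complex.norm_real, Real.norm_eq_abs, sq_abs]
  simp [s, mul_comm]

/-- By the partial trace condition the columns of `v`, indexed by `β`, are orthonormal, so a
combination of distinct columns has the norm of its coefficients. -/
theorem sum_norm_sq_eq {τ α β ζ : Type*} [Fintype τ] [Fintype α] [Fintype ζ] [DecidableEq β]
    (v : τ → α × β → ℂ)
    (hv : ∀ y y', ∑ k, ∑ x, starRingEnd ℂ (v k (x, y)) * v k (x, y') = if y = y' then 1 else 0)
    (φ : ζ → β) (hφ : Function.Injective φ) (c : ζ → ℂ) :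
    ∑ k, ∑ x, ‖∑ z, c z * starRingEnd ℂ (v k (x, φ z))‖ ^ 2 = ∑ z, ‖c z‖ ^ 2 := by
  classical
  apply Complex.ofReal_injective
  push_cast
  simp only [← Complex.ofReal_pow, ← Complex.normSq_eq_norm_sq, ← Complex.mul_conj, map_sum,
    Finset.sum_mul_sum, map_mul, Complex.conj_conj]
  calc _ = ∑ z, ∑ z', c z * starRingEnd ℂ (c z') *
        ∑ k, ∑ x, starRingEnd ℂ (v k (x, φ z)) * v k (x, φ z') := by
        simp only [Finset.mul_sum]
        simp only [← Fintype.sum_prod_type' (α₁ := τ) (α₂ := α),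
          ← Fintype.sum_prod_type' (α₁ := ζ) (α₂ := ζ)]
        rw [Finset.sum_comm]
        refine Finset.sum_congr rfl fun z _ => Finset.sum_congr rfl fun k _ => ?_
        ring
    _ = _ := by
        simp [hv, hφ.eq_iff]

/-- The upper bound on the fidelity, for a family of vectors that resolves the identity of the input
systems when the output system is traced out. -/
theorem sum_integral_norm_sq_le [DecidableEq ι] (hU : Continuous U) (contW : ∀ j, Continuous (W j))
    (hV : IsIrrList V (fun j : ι => U.tensor (W j).conj))
    (irrW : ∀ j, (W j).toRep.IsIrreducible)
    (p : ι → ℝ) (hp : ∀ j, 0 ≤ p j) {τ : Type*} [Fintype τ]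
    (v : τ → Fin d × (Fin d × Mem dim) → ℂ)
    (hv : ∀ y y', ∑ k, ∑ x, starRingEnd ℂ (v k (x, y)) * v k (x, y') = if y = y' then 1 else 0) :
    ∑ k, ∫ g, ‖∑ y, starRingEnd ℂ (v k y) * ((U g : Matrix (Fin d) (Fin d) ℂ) y.1 y.2.1 *
      starRingEnd ℂ (memoryState W p g y.2.2))‖ ^ 2 ∂μ
      ≤ ∑ K, (∑ j, (multiplicity (V K) (U.tensor (W j).conj) : ℝ) * Real.sqrt (p j)) ^ 2 := by
  choose A hA hAo hA1 using exists_tensor_decomposition hU contW hV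
  -- Rows carry the input system and the second memory factor, columns the output system and the
  -- first memory factor, matching the column and row indices of `U ⊗ U_j*`.
  let w : τ → (j : ι) → Matrix (Fin d × Fin (dim j)) (Fin d × Fin (dim j)) ℂ := fun k j =>
    Matrix.of fun y z => starRingEnd ℂ (v k (z.1, (y.1, ⟨j, z.2, y.2⟩)))
  have hw : ∀ k g, ∑ y, starRingEnd ℂ (v k y) * ((U g : Matrix (Fin d) (Fin d) ℂ) y.1 y.2.1 *
      starRingEnd ℂ (memoryState W p g y.2.2))
      = ∑ j, (Real.sqrt (p j / dim j) : ℂ) *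
        (w k j * (U.tensor (W j).conj g : Matrix (Fin d × Fin (dim j)) (Fin d × Fin (dim j)) ℂ)).trace := by
    intro k g
    simp only [memoryState_apply, Matrix.trace, Matrix.diag, Matrix.mul_apply, w, Matrix.of_apply,
      Fintype.sum_prod_type, Fintype.sum_sigma, URep.tensor, URep.conj]
    simp only [Finset.mul_sum]
    conv_lhs => enter [2, o]; rw [Finset.sum_comm]
    rw [Finset.sum_comm]
    refine Finset.sum_congr rfl fun j _ => ?_
    rw [Finset.sum_comm]
    refine Finset.sum_congr rfl fun a _ => ?_
    conv_rhs => rw [Finset.sum_comm]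
    refine Finset.sum_congr rfl fun o _ => ?_
    rw [Finset.sum_comm]
    refine Finset.sum_congr rfl fun c _ => Finset.sum_congr rfl fun b _ => ?_
    simp
    ring
  have hd0 : ∀ j, (dim j : ℝ) ≠ 0 := fun j => by
    have := nonempty_of_irreducible (irrW j)
    have := Fintype.card_ne_zero (α := Fin (dim j))
    rw [Fintype.card_fin] at this
    exact_mod_cast this
  have he0 : ∀ K, (e K : ℝ) ≠ 0 := fun K => by
    have := nonempty_of_irreducible (hV.irreducible K)
    have := Fintype.card_ne_zero (α := Fin (e K))
    rw [Fintype.card_fin] at this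
    exact_mod_cast this
  -- For a fixed first memory index `b`, summing over `k` and the output gives the squared norm `e
  -- K` of the isometry; the free index `b` contributes `dim j`.
  have hfrob : ∀ j K i, ∑ k, frobSq ((A j K i)ᴴ * w k j) = dim j * e K := by
    intro j K i
    have h1 : ∀ b f, ∑ k, ∑ x, ‖((A j K i)ᴴ * w k j) f (x, b)‖ ^ 2
        = ∑ z, ‖A j K i z f‖ ^ 2 := by
      intro b f
      have := sum_norm_sq_eq v hv (fun z : Fin d × Fin (dim j) => (z.1, ⟨j, b, z.2⟩)) (by
        rintro ⟨a, c⟩ ⟨a', c'⟩ h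
        simpa using h) (fun z => starRingEnd ℂ (A j K i z f))
      simpa [Matrix.mul_apply, w] using this
    have h2 : frobSq (A j K i) = e K := by
      apply Complex.ofReal_injective
      rw [ofReal_frobSq', hAo j K i i, if_pos rfl]
      simp
    calc ∑ k, frobSq ((A j K i)ᴴ * w k j)
        = ∑ b, ∑ f, ∑ k, ∑ x, ‖((A j K i)ᴴ * w k j) f (x, b)‖ ^ 2 := by
          simp only [frobSq, Fintype.sum_prod_type]
          rw [Finset.sum_comm]
          conv_rhs => rw [Finset.sum_comm]
          refine Finset.sum_congr rfl fun f _ => ?_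
          conv_rhs => rw [Finset.sum_comm]
          refine Finset.sum_congr rfl fun k _ => ?_
          rw [Finset.sum_comm]
      _ = ∑ b : Fin (dim j), frobSq (A j K i) := by
          refine Finset.sum_congr rfl fun b _ => ?_
          simp only [h1]
          rw [Finset.sum_comm]
          rfl
      _ = _ := by simp [h2]
  simp_rw [hw]
  refine (Finset.sum_le_sum fun k _ => integral_norm_sq_le μ hV.continuous hV.irreducible
    hV.inequivalent (fun j => U.tensor (W j).conj) A hA
    (fun j K i => by rw [hAo j K i i, if_pos rfl]) hA1 p hp (fun j => dim j) (fun j => by positivity)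
    (w k)).trans_eq ?_
  rw [Finset.sum_comm]
  refine Finset.sum_congr rfl fun K _ => ?_
  rw [← Finset.mul_sum, Finset.sum_comm]
  -- The factor `dim j` cancels the input-state weight, and `e K` will cancel the one from Schur
  -- orthogonality.
  have : ∀ j, ∑ k, Real.sqrt (p j) / dim j * ∑ i, frobSq ((A j K i)ᴴ * w k j)
      = e K * ((multiplicity (V K) (U.tensor (W j).conj) : ℝ) * Real.sqrt (p j)) := by
    intro j
    rw [← Finset.mul_sum, Finset.sum_comm]
    simp only [hfrob, Finset.sum_const, Finset.card_univ, Fintype.card_fin, nsmul_eq_mul]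
    field_simp [hd0 j]
  simp_rw [this]
  rw [← Finset.mul_sum, div_mul_eq_mul_div]
  field_simp [he0 K]

end Main

/-! ### Positive semidefinite matrices -/

section PositiveSemidefinite

variable {Ω : Type*} [MeasurableSpace Ω] {n : Type*} [Fintype n]

open scoped MatrixOrder in
theorem exists_eq_conjTranspose_mul_self [DecidableEq n] {A : Matrix n n ℂ} (hA : A.PosSemidef) :
    ∃ B : Matrix n n ℂ, A = Bᴴ * B :=
  CStarAlgebra.nonneg_iff_eq_star_mul_self.mp hA.nonneg

theorem sum_conj_mul_mul_eq {m : Type*} [Fintype m] (B : Matrix m n ℂ) (ψ : n → ℂ) :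
    ∑ y, ∑ y', starRingEnd ℂ (ψ y) * (Bᴴ * B) y y' * ψ y'
      = ((∑ k, ‖∑ y, B k y * ψ y‖ ^ 2 : ℝ) : ℂ) := by
  push_cast
  simp only [← Complex.ofReal_pow, ← Complex.normSq_eq_norm_sq, ← Complex.mul_conj, map_sum,
    map_mul, Matrix.mul_apply, Matrix.conjTranspose_apply, Finset.mul_sum,
    Finset.sum_mul]
  simp only [← Fintype.sum_prod_type' (α₁ := n) (α₂ := n)]
  rw [Finset.sum_comm]
  refine Finset.sum_congr rfl fun k _ => ?_
  rw [Fintype.sum_prod_type, Fintype.sum_prod_type]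
  refine Finset.sum_congr rfl fun y _ => Finset.sum_congr rfl fun y' _ => ?_
  rw [Complex.star_def]
  ring

theorem posSemidef_integral {μ : Measure Ω} {D : Ω → Matrix n n ℂ}
    (hD : ∀ x y, Integrable (fun g => D g x y) μ) (hpos : ∀ g, (D g).PosSemidef) :
    (Matrix.of fun x y => ∫ g, D g x y ∂μ).PosSemidef := by
  refine Matrix.PosSemidef.of_dotProduct_mulVec_nonneg ?_ fun v => ?_
  · ext x y
    rw [Matrix.conjTranspose_apply, Matrix.of_apply, Matrix.of_apply, Complex.star_def,
      ← integral_conj]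
    congr 1
    ext g
    exact (hpos g).isHermitian.apply x y
  · have : star v ⬝ᵥ ((Matrix.of fun x y => ∫ g, D g x y ∂μ) *ᵥ v)
        = ∫ g, star v ⬝ᵥ (D g *ᵥ v) ∂μ := by
      simp only [dotProduct, Matrix.mulVec, Matrix.of_apply]
      rw [integral_finsetSum _ fun x _ => (integrable_finsetSum _ fun y _ =>
        (hD x y).mul_const _).const_mul _]
      refine Finset.sum_congr rfl fun x _ => ?_
      rw [integral_const_mul, integral_finsetSum _ fun y _ => (hD x y).mul_const _]
      simp_rw [integral_mul_const]
    rw [this]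
    exact integral_nonneg fun g => (hpos g).dotProduct_mulVec_nonneg v

end PositiveSemidefinite

/-! ### POVMs with an operator density and their outcome laws -/

section Densities

variable {Ω : Type*} [MeasurableSpace Ω] {n : Type*} [Fintype n] [DecidableEq n]

open Classical in
/-- The POVM with a given operator density. -/
def POVM.ofDensity (μ : Measure Ω) (D : Ω → Matrix n n ℂ)
    (hD : ∀ x y, Integrable (fun g => D g x y) μ) (hpos : ∀ g, (D g).PosSemidef)
    (hone : (Matrix.of fun x y => ∫ g, D g x y ∂μ) = 1) : POVM Ω n where
  effect :=
    -- A vector measure must vanish on nonmeasurable sets.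
    { measureOf' := fun B => if MeasurableSet B then Matrix.of fun x y => ∫ g in B, D g x y ∂μ else 0
      empty' := by
        ext
        simp
      not_measurable' := fun _ hs => if_neg hs
      m_iUnion' := fun f hf hd => by
        rw [if_pos (MeasurableSet.iUnion hf)]
        simp only [hf, if_true]
        exact Pi.hasSum.2 fun x => Pi.hasSum.2 fun y =>
          hasSum_integral_iUnion hf hd (hD x y).integrableOn }
  posSemidef B := by
    change (if MeasurableSet B then _ else _ : Matrix n n ℂ).PosSemidef
    split_ifs
    · exact posSemidef_integral (fun x y => (hD x y).integrableOn) hpos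
    · exact Matrix.PosSemidef.zero
  normalized := by
    change (if MeasurableSet Set.univ then _ else _ : Matrix n n ℂ) = 1
    rw [if_pos MeasurableSet.univ, ← hone]
    simp

theorem POVM.hasDensity_ofDensity (μ : Measure Ω) (D : Ω → Matrix n n ℂ)
    (hD : ∀ x y, Integrable (fun g => D g x y) μ) (hpos : ∀ g, (D g).PosSemidef)
    (hone : (Matrix.of fun x y => ∫ g, D g x y ∂μ) = 1) :
    (POVM.ofDensity μ D hD hpos hone).HasDensity μ D := by
  intro B hB x y
  refine ⟨(hD x y).integrableOn, ?_⟩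
  classical
  change (if MeasurableSet B then _ else _ : Matrix n n ℂ) x y = _
  rw [if_pos hB]
  rfl

theorem POVM.law_apply (P : POVM Ω n) (ψ : n → ℂ) {B : Set Ω} (hB : MeasurableSet B) :
    (P.law ψ).real B = expectation ψ (P.effect B) := by
  rw [POVM.law, SignedMeasure.toMeasureOfZeroLE_real_apply _ _ _ hB, Set.univ_inter]
  rfl

instance POVM.isFiniteMeasure_law (P : POVM Ω n) (ψ : n → ℂ) : IsFiniteMeasure (P.law ψ) := by
  unfold POVM.law
  infer_instance

theorem POVM.law_eq_withDensity (μ : Measure Ω) (P : POVM Ω n) (η : Ω → n → ℂ)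
    (hP : P.HasDensity μ fun g => ketbra (η g)) (ψ : n → ℂ) :
    P.law ψ = μ.withDensity fun g => ENNReal.ofReal (‖star ψ ⬝ᵥ η g‖ ^ 2) := by
  have hi : ∀ x y, Integrable (fun g => ketbra (η g) x y) μ := fun x y => by
    simpa using (hP Set.univ MeasurableSet.univ x y).1
  have hexp : ∀ g, ((‖star ψ ⬝ᵥ η g‖ ^ 2 : ℝ) : ℂ)
      = ∑ x, ∑ y, starRingEnd ℂ (ψ x) * ψ y * ketbra (η g) x y := by
    intro g
    rw [← Complex.normSq_eq_norm_sq, ← Complex.mul_conj, dotProduct, map_sum, Finset.sum_mul_sum]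
    refine Finset.sum_congr rfl fun x _ => Finset.sum_congr rfl fun y _ => ?_
    simp [ketbra, Matrix.vecMulVec_apply]
    ring
  have hint : Integrable (fun g => ‖star ψ ⬝ᵥ η g‖ ^ 2) μ := by
    have : Integrable (fun g => ((‖star ψ ⬝ᵥ η g‖ ^ 2 : ℝ) : ℂ)) μ := by
      simp_rw [hexp]
      exact integrable_finsetSum _ fun x _ => integrable_finsetSum _ fun y _ =>
        (hi x y).const_mul _
    exact this.re
  ext B hB
  rw [withDensity_apply _ hB, ← ofReal_integral_eq_lintegral_ofReal hint.integrableOn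
    (.of_forall fun g => by positivity), ← ENNReal.ofReal_toReal (measure_ne_top (P.law ψ) B)]
  congr 1
  change (P.law ψ).real B = _
  rw [POVM.law_apply P ψ hB]
  apply Complex.ofReal_injective
  rw [← integral_complex_ofReal]
  simp_rw [hexp]
  rw [integral_finsetSum _ fun x _ => integrable_finsetSum _ fun y _ =>
        ((hi x y).const_mul _).integrableOn]
  -- Positivity of the effect makes the quadratic form real, so taking its real part loses nothing.
  have h1 : ((expectation ψ (P.effect B) : ℝ) : ℂ) = star ψ ⬝ᵥ (P.effect B *ᵥ ψ) := by
    have := (Complex.nonneg_iff.1 ((P.posSemidef B).dotProduct_mulVec_nonneg ψ)).2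
    apply Complex.ext
    · rfl
    · simpa using this
  rw [h1, dotProduct]
  refine Finset.sum_congr rfl fun x _ => ?_
  rw [integral_finsetSum _ fun y _ => ((hi x y).const_mul _).integrableOn]
  simp_rw [integral_const_mul]
  simp only [Matrix.mulVec, dotProduct, (hP B hB _ _).2, Finset.mul_sum, Pi.star_apply,
    Complex.star_def]
  refine Finset.sum_congr rfl fun y _ => ?_
  ring

end Densities

/-! ### Channels from Kraus operators, and Choi operators -/

section Channels

variable {Ω : Type*} [MeasurableSpace Ω] {m n : Type*} [Fintype m]

theorem integrable_kraus {μ : Measure Ω} {K : Ω → Matrix n m ℂ}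
    (hK : ∀ x y a b, Integrable (fun g => K g x a * starRingEnd ℂ (K g y b)) μ)
    (ρ : Matrix m m ℂ) (x y : n) : Integrable (fun g => (K g * ρ * (K g)ᴴ) x y) μ := by
  have : ∀ g, (K g * ρ * (K g)ᴴ) x y
      = ∑ b, ∑ a, ρ a b * (K g x a * starRingEnd ℂ (K g y b)) := by
    intro g
    simp only [Matrix.mul_apply, Finset.sum_mul, Matrix.conjTranspose_apply, Complex.star_def]
    refine Finset.sum_congr rfl fun b _ => Finset.sum_congr rfl fun a _ => ?_
    ring
  simp_rw [this]
  exact integrable_finsetSum _ fun b _ => integrable_finsetSum _ fun a _ => (hK x y a b).const_mul _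

variable [Fintype n]

/-- The channel with a given family of Kraus operators. -/
def QChannel.ofKraus [DecidableEq m] (μ : Measure Ω) (K : Ω → Matrix n m ℂ)
    (hK : ∀ x y a b, Integrable (fun g => K g x a * starRingEnd ℂ (K g y b)) μ)
    (hone : ∀ a b, ∫ g, ((K g)ᴴ * K g) a b ∂μ = (1 : Matrix m m ℂ) a b) : QChannel m n where
  toLin :=
    { toFun := fun ρ => Matrix.of fun x y => ∫ g, (K g * ρ * (K g)ᴴ) x y ∂μ
      map_add' := fun ρ σ => by
        ext x y
        simp only [Matrix.mul_add, Matrix.add_mul, Matrix.add_apply, Matrix.of_apply]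
        exact integral_add (integrable_kraus hK ρ x y) (integrable_kraus hK σ x y)
      map_smul' := fun c ρ => by
        ext x y
        simp only [Matrix.mul_smul, Matrix.smul_mul, Matrix.smul_apply, Matrix.of_apply]
        exact integral_const_mul c _ }
  completelyPositive k X hX := by
    -- Ampliation replaces `K g` by `K g ⊗ 1`, so the extended map is an integral of positive
    -- operators.
    have h : ∀ g (x y : n × Fin k),
        ((K g ⊗ₖ (1 : Matrix (Fin k) (Fin k) ℂ)) * X * (K g ⊗ₖ (1 : Matrix (Fin k) (Fin k) ℂ))ᴴ) x y
          = (K g * (Matrix.of fun a b => X (a, x.2) (b, y.2)) * (K g)ᴴ) x.1 y.1 := by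
      intro g x y
      simp [Matrix.mul_apply, Fintype.sum_prod_type, Matrix.one_apply, apply_ite (starRingEnd ℂ)]
    have h2 := posSemidef_integral (μ := μ)
      (D := fun g => (K g ⊗ₖ (1 : Matrix (Fin k) (Fin k) ℂ)) * X *
        (K g ⊗ₖ (1 : Matrix (Fin k) (Fin k) ℂ))ᴴ)
      (fun x y => by
        simp_rw [h]
        exact integrable_kraus hK _ _ _)
      (fun g => hX.mul_mul_conjTranspose_same _)
    simp_rw [h] at h2
    exact h2
  tracePreserving ρ := by
    change ∑ x, ∫ g, (K g * ρ * (K g)ᴴ) x x ∂μ = ρ.trace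
    rw [← integral_finsetSum _ fun x _ => integrable_kraus hK ρ x x]
    have h : ∀ g, ∑ x, (K g * ρ * (K g)ᴴ) x x = ∑ a, ∑ b, ((K g)ᴴ * K g) a b * ρ b a := by
      intro g
      change (K g * ρ * (K g)ᴴ).trace = (((K g)ᴴ * K g) * ρ).trace
      rw [Matrix.trace_mul_comm, Matrix.mul_assoc]
    have hi : ∀ a b, Integrable (fun g => ((K g)ᴴ * K g) a b) μ := by
      intro a b
      simp only [Matrix.mul_apply, Matrix.conjTranspose_apply, Complex.star_def]
      refine integrable_finsetSum _ fun x _ => ?_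
      simp_rw [mul_comm]
      exact hK x x b a
    simp_rw [h]
    rw [integral_finsetSum _ fun a _ => integrable_finsetSum _ fun b _ => (hi a b).mul_const _,
      Matrix.trace]
    refine Finset.sum_congr rfl fun a _ => ?_
    rw [integral_finsetSum _ fun b _ => (hi a b).mul_const _]
    simp_rw [integral_mul_const, hone]
    simp [Matrix.one_apply]

/-- Complete positivity is stated for ancillas `Fin k`; relabelling gives any finite ancilla, in
particular the copy of the input used by the Choi operator. -/
theorem ampliate_posSemidef (R : QChannel m n) (k : Type*) [Fintype k]
    (X : Matrix (m × k) (m × k) ℂ) (hX : X.PosSemidef) : (ampliate R.toLin k X).PosSemidef := by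
  have := (R.completelyPositive (Fintype.card k)
    (X.submatrix (Prod.map id (Fintype.equivFin k).symm) (Prod.map id (Fintype.equivFin k).symm))
    (hX.submatrix _)).submatrix (Prod.map id (Fintype.equivFin k))
  convert this using 1
  ext x y
  simp [ampliate]

variable [DecidableEq m]

theorem choi_posSemidef (R : QChannel m n) : (choi R.toLin).PosSemidef :=
  ampliate_posSemidef R m _ (Matrix.posSemidef_vecMulVec_self_star _)

theorem choi_apply {m n : Type*} [DecidableEq m] (C : Matrix m m ℂ →ₗ[ℂ] Matrix n n ℂ)
    (x y : n) (a b : m) :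
    choi C (x, a) (y, b) = C (Matrix.single a b 1) x y := by
  have : (Matrix.of fun a' b' => ketbra (dket (1 : Matrix m m ℂ)) (a', a) (b', b))
      = Matrix.single a b 1 := by
    ext a' b'
    by_cases h1 : a = a' <;> by_cases h2 : b = b' <;>
      simp [ketbra, dket, Matrix.vecMulVec_apply, Matrix.one_apply, @eq_comm _ a' a,
        @eq_comm _ b' b, h1, h2]
  rw [choi, ampliate, Matrix.of_apply, this]

/-- Trace preservation on matrix units: this is the partial trace condition that feeds the upper
bound. -/
theorem sum_choi (R : QChannel m n) (a b : m) :
    ∑ x, choi R.toLin (x, a) (x, b) = if a = b then 1 else 0 := by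
  simp only [choi_apply]
  refine (R.tracePreserving (Matrix.single a b 1)).trans ?_
  split_ifs with h
  · subst h; simp
  · exact Matrix.trace_single_eq_of_ne _ _ _ h

end Channels

/-! ### Fidelity as a quadratic form of the Choi operator -/

section JointVector

variable {H M : Type*} [Fintype H] [DecidableEq H] [Fintype M] [DecidableEq M]

/-- The vector `|A⟩⟩ ⊗ |ψ*⟩`. -/
def jointVec (A : Matrix H H ℂ) (ψ : M → ℂ) : H × (H × M) → ℂ :=
  fun y => A y.1 y.2.1 * starRingEnd ℂ (ψ y.2.2)

/-- Expanding `|ψ⟩⟨ψ|` in matrix units contracts the memory legs of the Choi operator of `R` with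
`ψ`. -/
theorem choi_retrieved_apply (R : QChannel (H × M) H) (ψ : M → ℂ) (x y a b : H) :
    choi (retrieved R ψ) (x, a) (y, b)
      = ∑ m, ∑ n, ψ m * starRingEnd ℂ (ψ n) * choi R.toLin (x, (a, m)) (y, (b, n)) := by
  have h : (Matrix.single a b (1 : ℂ)) ⊗ₖ ketbra ψ
      = ∑ m, ∑ n, (ψ m * starRingEnd ℂ (ψ n)) • Matrix.single (a, m) (b, n) (1 : ℂ) := by
    conv_lhs => rw [Matrix.matrix_eq_sum_single (ketbra ψ)]
    ext ⟨a', m'⟩ ⟨b', n'⟩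
    simp [Matrix.sum_apply, Matrix.single_apply, ketbra, Matrix.vecMulVec_apply, ite_and]
  simp only [choi_apply]
  change R.toLin ((Matrix.single a b (1 : ℂ)) ⊗ₖ ketbra ψ) x y = _
  rw [h]
  simp only [map_sum, map_smul, Matrix.sum_apply, Matrix.smul_apply, smul_eq_mul]

/-- Inserting `ψ` into the channel transposes it in the Choi picture, hence the conjugate in
`jointVec`. The fidelity becomes a quadratic form of one operator independent of `ψ`. -/
theorem expectation_choi_retrieved (R : QChannel (H × M) H) (A : Matrix H H ℂ) (ψ : M → ℂ) :
    expectation (dket A) (choi (retrieved R ψ))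
      = (∑ y, ∑ y', starRingEnd ℂ (jointVec A ψ y) * choi R.toLin y y' * jointVec A ψ y').re := by
  change (star (dket A) ⬝ᵥ (choi (retrieved R ψ) *ᵥ dket A)).re = _
  congr 1
  simp only [dotProduct, Matrix.mulVec, Fintype.sum_prod_type, choi_retrieved_apply, jointVec,
    Pi.star_apply, dket, Finset.mul_sum, Finset.sum_mul]
  refine Finset.sum_congr rfl fun x _ => Finset.sum_congr rfl fun a _ => ?_
  conv_lhs => enter [2, y]; rw [Finset.sum_comm]
  rw [Finset.sum_comm]
  refine Finset.sum_congr rfl fun m _ => Finset.sum_congr rfl fun y _ =>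
    Finset.sum_congr rfl fun b _ => Finset.sum_congr rfl fun n _ => ?_
  simp
  ring

theorem expectation_choi_ofKraus {Ω : Type*} [MeasurableSpace Ω] {μ : Measure Ω}
    {K : Ω → Matrix H (H × M) ℂ}
    (hK : ∀ x y a b, Integrable (fun g => K g x a * starRingEnd ℂ (K g y b)) μ)
    (hone : ∀ a b, ∫ g, ((K g)ᴴ * K g) a b ∂μ = (1 : Matrix _ _ ℂ) a b)
    (A : Matrix H H ℂ) (ψ : M → ℂ) :
    expectation (dket A) (choi (retrieved (QChannel.ofKraus μ K hK hone) ψ))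
      = ∫ g, ‖∑ y, starRingEnd ℂ (jointVec A ψ y) * K g y.1 y.2‖ ^ 2 ∂μ := by
  rw [expectation_choi_retrieved]
  have hchoi : ∀ y y', choi (QChannel.ofKraus μ K hK hone).toLin y y'
      = ∫ g, K g y.1 y.2 * starRingEnd ℂ (K g y'.1 y'.2) ∂μ := by
    rintro ⟨x, a⟩ ⟨y, b⟩
    rw [choi_apply]
    change ∫ g, (K g * Matrix.single a b (1 : ℂ) * (K g)ᴴ) x y ∂μ = _
    congr 1
    ext g
    rw [Matrix.mul_assoc, Matrix.mul_apply, Finset.sum_eq_single a]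
    · simp [Matrix.single_mul_apply_same]
    · intro x _ hx
      simp [Matrix.single_mul_apply_of_ne, hx]
    · simp
  suffices h : ∑ y, ∑ y', starRingEnd ℂ (jointVec A ψ y) *
      choi (QChannel.ofKraus μ K hK hone).toLin y y' * jointVec A ψ y'
      = ((∫ g, ‖∑ y, starRingEnd ℂ (jointVec A ψ y) * K g y.1 y.2‖ ^ 2 ∂μ : ℝ) : ℂ) by
    rw [h, Complex.ofReal_re]
  rw [← integral_complex_ofReal]
  have hexp : ∀ g, ((‖∑ y, starRingEnd ℂ (jointVec A ψ y) * K g y.1 y.2‖ ^ 2 : ℝ) : ℂ)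
      = ∑ y, ∑ y', (starRingEnd ℂ (jointVec A ψ y) * jointVec A ψ y') *
        (K g y.1 y.2 * starRingEnd ℂ (K g y'.1 y'.2)) := by
    intro g
    rw [← Complex.normSq_eq_norm_sq, ← Complex.mul_conj, map_sum, Finset.sum_mul_sum]
    refine Finset.sum_congr rfl fun x _ => Finset.sum_congr rfl fun y _ => ?_
    rw [map_mul, Complex.conj_conj]
    ring
  simp_rw [hexp]
  rw [integral_finsetSum _ fun y _ => integrable_finsetSum _ fun y' _ => (hK _ _ _ _).const_mul _]
  refine Finset.sum_congr rfl fun y _ => ?_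
  rw [integral_finsetSum _ fun y' _ => (hK _ _ _ _).const_mul _]
  refine Finset.sum_congr rfl fun y' _ => ?_
  rw [integral_const_mul, hchoi]
  ring

/-- An inner product of product vectors factorizes. -/
theorem sum_jointVec_mul {H M : Type*} [Fintype H] [Fintype M] (A B : Matrix H H ℂ) (ψ η : M → ℂ) :
    ∑ y, starRingEnd ℂ (jointVec A ψ y) * jointVec B η y
      = (Aᴴ * B).trace * starRingEnd ℂ (star ψ ⬝ᵥ η) := by
  rw [← star_dotProduct_dket_eq_trace]
  simp only [dotProduct, Fintype.sum_prod_type, jointVec, map_sum, dket, Pi.star_apply,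
    Finset.sum_mul]
  refine Finset.sum_congr rfl fun x _ => ?_
  simp only [Finset.mul_sum]
  refine Finset.sum_congr rfl fun a _ => Finset.sum_congr rfl fun m _ => ?_
  simp
  ring

end JointVector

/-! ### Upper bound for retrieving channels -/

section Fidelities

variable {G : Type*} [Group G] [TopologicalSpace G] [IsTopologicalGroup G]
    [CompactSpace G] [MeasurableSpace G] [BorelSpace G] (μ : Measure G) [μ.IsHaarMeasure]
    [IsProbabilityMeasure μ] {d : ℕ} {U : URep G (Fin d)}
    {κ : Type*} [Fintype κ] {e : κ → ℕ} {V : (K : κ) → URep G (Fin (e K))}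
    {ι : Type*} [Fintype ι] [DecidableEq ι] {dim : ι → ℕ} {W : (j : ι) → URep G (Fin (dim j))}

theorem continuous_memoryState {G : Type*} [Group G] [TopologicalSpace G]
    {W : (j : ι) → URep G (Fin (dim j))} (contW : ∀ j, Continuous (W j)) (p : ι → ℝ) (x : Mem dim) :
    Continuous fun g => memoryState W p g x := by
  simp only [memoryState_apply]
  exact continuous_const.mul (URep.continuous_apply (contW _) _ _)

/-- The conjugated rows of a factor `B` of the Choi operator serve as the vectors in
`sum_integral_norm_sq_le`; `sum_choi` supplies their normalization. -/
theorem learningFidelity_le (hU : Continuous U) (contW : ∀ j, Continuous (W j))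
    (hV : IsIrrList V (fun j : ι => U.tensor (W j).conj))
    (irrW : ∀ j, (W j).toRep.IsIrreducible) (p : ι → ℝ) (hp : ∀ j, 0 ≤ p j)
    (R : QChannel (Fin d × Mem dim) (Fin d)) :
    learningFidelity μ U (memoryState W p) R ≤ (1 / (d : ℝ) ^ 2) *
      ∑ K, (∑ j, (multiplicity (V K) (U.tensor (W j).conj) : ℝ) * Real.sqrt (p j)) ^ 2 := by
  rw [learningFidelity]
  refine mul_le_mul_of_nonneg_left ?_ (by positivity)
  obtain ⟨B, hB⟩ := exists_eq_conjTranspose_mul_self (choi_posSemidef R)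
  have hE : ∀ g, expectation (dket (U g : Matrix (Fin d) (Fin d) ℂ))
      (choi (retrieved R (memoryState W p g)))
      = ∑ k, ‖∑ y, B k y * jointVec (U g : Matrix (Fin d) (Fin d) ℂ) (memoryState W p g) y‖ ^ 2 := by
    intro g
    rw [expectation_choi_retrieved, hB, sum_conj_mul_mul_eq, Complex.ofReal_re]
  have hcU := URep.continuous_apply hU
  have hcW := continuous_memoryState contW p
  simp_rw [hE]
  rw [integral_finsetSum _ fun k _ => integrable_of_continuous μ (by
    simp only [jointVec]
    fun_prop)]
  have h := sum_integral_norm_sq_le μ hU contW hV irrW p hp (fun k y => starRingEnd ℂ (B k y)) (by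
    intro y y'
    simp only [Complex.conj_conj]
    rw [Finset.sum_comm]
    have h1 := sum_choi R y' y
    rw [hB] at h1
    simp only [Matrix.mul_apply, Matrix.conjTranspose_apply, Complex.star_def] at h1
    have h2 : (if y = y' then (1 : ℂ) else 0) = if y' = y then 1 else 0 := by
      simp only [eq_comm]
    rw [h2, ← h1]
    simp_rw [mul_comm])
  simpa only [Complex.conj_conj, jointVec] using h

end Fidelities

/-! ### Uniform approximation by simple functions -/

section Discretization

/-- A continuous function on a product of compact spaces is uniformly approximated by functions that
are simple in the second variable. -/
theorem exists_simpleFunc_dist_lt {X : Type*} [TopologicalSpace X] [CompactSpace X] [Nonempty X]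
    [MeasurableSpace X] [BorelSpace X] {f : X → X → ℝ} (hf : Continuous fun x : X × X => f x.1 x.2)
    {ε : ℝ} (hε : 0 < ε) : ∃ c : SimpleFunc X X, ∀ x y, |f x y - f x (c y)| < ε := by
  -- `Φ y` is `f (·, y)` in the sup norm. Its continuity makes the approximation uniform in `x`.
  let Φ : C(X, C(X, ℝ)) := ContinuousMap.curry ⟨fun z : X × X => f z.2 z.1, by fun_prop⟩
  let O : X → Set X := fun z => {y | dist (Φ y) (Φ z) < ε}
  have hO : ∀ z, IsOpen (O z) := fun z =>
    isOpen_lt (Φ.continuous.dist continuous_const) continuous_const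
  obtain ⟨t, ht⟩ := isCompact_univ.elim_finite_subcover O hO fun y _ =>
    Set.mem_iUnion.2 ⟨y, by simpa [O] using hε⟩
  have key : ∀ s : Finset X, ∃ c : SimpleFunc X X, ∀ y ∈ ⋃ z ∈ s, O z, dist (Φ y) (Φ (c y)) < ε := by
    classical
    intro s
    induction s using Finset.induction with
    | empty => exact ⟨SimpleFunc.const X (Classical.arbitrary X), by simp⟩
    | insert a s _ ih =>
      obtain ⟨c, hc⟩ := ih
      -- Overwriting on `O a` builds a measurable choice of centre from the finite cover.
      refine ⟨SimpleFunc.piecewise (O a) (hO a).measurableSet (SimpleFunc.const X a) c, ?_⟩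
      intro y hy
      rw [SimpleFunc.coe_piecewise]
      by_cases h : y ∈ O a
      · rw [Set.piecewise_eq_of_mem _ _ _ h]
        exact h
      · rw [Set.piecewise_eq_of_notMem _ _ _ h]
        refine hc y ?_
        rw [Finset.set_biUnion_insert] at hy
        exact hy.resolve_left h
  obtain ⟨c, hc⟩ := key t
  refine ⟨c, fun x y => ?_⟩
  have h1 := (ContinuousMap.dist_apply_le_dist x).trans_lt (hc y (ht trivial))
  rwa [Real.dist_eq] at h1

end Discretization

/-! ### Upper bound for POVMs -/

section Estimation

variable {G : Type*} [Group G] [TopologicalSpace G] [IsTopologicalGroup G]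
    [CompactSpace G] [MeasurableSpace G] [BorelSpace G] (μ : Measure G) [μ.IsHaarMeasure]
    [IsProbabilityMeasure μ] {d : ℕ} {U : URep G (Fin d)}
    {κ : Type*} [Fintype κ] {e : κ → ℕ} {V : (K : κ) → URep G (Fin (e K))}
    {ι : Type*} [Fintype ι] [DecidableEq ι] {dim : ι → ℕ} {W : (j : ι) → URep G (Fin (dim j))}

theorem sum_effect_preimage {Ω n : Type*} [MeasurableSpace Ω] [Fintype n] [DecidableEq n]
    (P : POVM Ω n) {β : Type*} (c : SimpleFunc Ω β) :
    ∑ z : c.range, P.effect (c ⁻¹' {z.1}) = 1 := by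
  rw [← P.normalized, Finset.sum_coe_sort c.range fun z => P.effect (c ⁻¹' {z}),
    ← VectorMeasure.of_biUnion_finset]
  · congr 1
    ext x
    simp
  · intro z _ z' _ hzz
    exact Disjoint.preimage _ (by simpa using hzz)
  · intro z _
    exact c.measurableSet_fiber z

/-- The estimation bound for a POVM with finitely many outcomes. -/
theorem sum_integral_fidelity_mul_law_le (hU : Continuous U) (contW : ∀ j, Continuous (W j))
    (hV : IsIrrList V (fun j : ι => U.tensor (W j).conj))
    (irrW : ∀ j, (W j).toRep.IsIrreducible) (p : ι → ℝ) (hp : ∀ j, 0 ≤ p j)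
    (P : POVM G (Mem dim)) (c : SimpleFunc G G) :
    ∑ z : c.range, ∫ g, ‖((U g : Matrix (Fin d) (Fin d) ℂ)ᴴ *
        (U z.1 : Matrix (Fin d) (Fin d) ℂ)).trace‖ ^ 2 *
        (P.law (memoryState W p g)).real (c ⁻¹' {z.1}) ∂μ
      ≤ ∑ K, (∑ j, (multiplicity (V K) (U.tensor (W j).conj) : ℝ) * Real.sqrt (p j)) ^ 2 := by
  choose B hB using fun z : c.range =>
    exists_eq_conjTranspose_mul_self (P.posSemidef (c ⁻¹' {z.1}))
  have hcU := URep.continuous_apply hU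
  have hcW := continuous_memoryState contW p
  have hlaw : ∀ (z : c.range) (ψ : Mem dim → ℂ), (P.law ψ).real (c ⁻¹' {z.1})
      = ∑ r, ‖∑ m, B z r m * ψ m‖ ^ 2 := by
    intro z ψ
    rw [POVM.law_apply P ψ (c.measurableSet_fiber z), hB]
    have h := congrArg Complex.re (sum_conj_mul_mul_eq (B z) ψ)
    rw [Complex.ofReal_re] at h
    rw [← h]
    change (star ψ ⬝ᵥ (((B z)ᴴ * B z) *ᵥ ψ)).re = _
    simp only [dotProduct, Matrix.mulVec, Finset.mul_sum, Pi.star_apply, Complex.star_def, mul_assoc]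
  -- Kraus vectors of the strategy that measures the coarse-grained POVM and applies the guess `U
  -- z`. Unitarity of `U z` and completeness of the effects give their normalization.
  let v : (c.range × Mem dim) → Fin d × (Fin d × Mem dim) → ℂ := fun k =>
    jointVec (U k.1.1 : Matrix (Fin d) (Fin d) ℂ) (fun m => starRingEnd ℂ (B k.1 k.2 m))
  have hv : ∀ y y', ∑ k, ∑ x, starRingEnd ℂ (v k (x, y)) * v k (x, y') = if y = y' then 1 else 0 := by
    rintro ⟨a, m⟩ ⟨a', m'⟩
    have h1 : ∀ z : G, ∑ x, starRingEnd ℂ ((U z : Matrix (Fin d) (Fin d) ℂ) x a) *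
        (U z : Matrix (Fin d) (Fin d) ℂ) x a' = if a = a' then 1 else 0 := by
      intro z
      have := congrFun (congrFun (Matrix.mem_unitaryGroup_iff'.1 (U z).2) a) a'
      rw [Matrix.mul_apply, Matrix.one_apply] at this
      exact this
    have h2 : ∑ z : c.range, ∑ r, starRingEnd ℂ (B z r m) * B z r m' = if m = m' then 1 else 0 := by
      have := congrFun (congrFun (sum_effect_preimage P c) m) m'
      simp only [hB, Matrix.sum_apply, Matrix.one_apply] at this
      exact this
    simp only [v, jointVec, Complex.conj_conj, map_mul, Fintype.sum_prod_type, mul_mul_mul_comm,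
      ← Finset.sum_mul, h1]
    simp only [← Finset.mul_sum, h2]
    by_cases ha : a = a' <;> by_cases hm : m = m' <;> simp [ha, hm]
  have h := sum_integral_norm_sq_le μ hU contW hV irrW p hp v hv
  refine le_trans (le_of_eq ?_) h
  rw [Fintype.sum_prod_type]
  refine Finset.sum_congr rfl fun z _ => ?_
  rw [← integral_finsetSum _ fun r _ => integrable_of_continuous μ (by fun_prop)]
  congr 1
  ext g
  rw [hlaw, Finset.mul_sum]
  refine Finset.sum_congr rfl fun r _ => ?_
  have h1 := sum_jointVec_mul (U z.1 : Matrix (Fin d) (Fin d) ℂ) (U g : Matrix (Fin d) (Fin d) ℂ)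
    (fun m => starRingEnd ℂ (B z r m)) (memoryState W p g)
  simp only [jointVec] at h1
  simp only [v, jointVec, h1, norm_mul, mul_pow, Complex.norm_conj]
  congr 2
  · rw [← Complex.norm_conj, ← Complex.star_def, ← Matrix.trace_conjTranspose,
      Matrix.conjTranspose_mul, Matrix.conjTranspose_conjTranspose]
  · simp [dotProduct]

/-- Replacing the outcome `h` by `c h` changes the fidelity uniformly little and leaves a POVM with
finitely many outcomes, to which the previous bound applies. -/
theorem estimationFidelity_le (hU : Continuous U) (contW : ∀ j, Continuous (W j))
    (hV : IsIrrList V (fun j : ι => U.tensor (W j).conj))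
    (irrW : ∀ j, (W j).toRep.IsIrreducible) (p : ι → ℝ) (hp : ∀ j, 0 ≤ p j)
    (P : POVM G (Mem dim)) :
    estimationFidelity μ U (memoryState W p) P ≤ (1 / (d : ℝ) ^ 2) *
      ∑ K, (∑ j, (multiplicity (V K) (U.tensor (W j).conj) : ℝ) * Real.sqrt (p j)) ^ 2 := by
  have hcU := URep.continuous_apply hU
  have hcW := continuous_memoryState contW p
  let f : G → G → ℝ := fun g h => (‖((U g : Matrix (Fin d) (Fin d) ℂ)ᴴ *
    (U h : Matrix (Fin d) (Fin d) ℂ)).trace‖ / (d : ℝ)) ^ 2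
  have hf : Continuous fun x : G × G => f x.1 x.2 := by
    simp only [f, Matrix.trace, Matrix.diag, Matrix.mul_apply, Matrix.conjTranspose_apply]
    fun_prop
  have hlaw : ∀ B, MeasurableSet B →
      Continuous fun g => (P.law (memoryState W p g)).real B := by
    intro B hB
    simp_rw [POVM.law_apply P _ hB]
    change Continuous fun g => (star (memoryState W p g) ⬝ᵥ (P.effect B *ᵥ memoryState W p g)).re
    simp only [dotProduct, Matrix.mulVec, Pi.star_apply]
    fun_prop
  set C : ℝ := ∫ g, (P.law (memoryState W p g)).real Set.univ ∂μ with hC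
  have hC0 : 0 ≤ C := integral_nonneg fun g => measureReal_nonneg
  refine le_of_forall_pos_le_add fun ε hε => ?_
  -- The total error is this tolerance times the average mass `C`, hence at most `ε`; `C + 1` keeps
  -- the denominator positive without evaluating `C`.
  obtain ⟨c, hc⟩ := exists_simpleFunc_dist_lt hf (div_pos hε (by linarith : 0 < C + 1))
  have hinner : ∀ g, ∫ h, f g h ∂(P.law (memoryState W p g))
      ≤ ∑ z : c.range, f g z.1 * (P.law (memoryState W p g)).real (c ⁻¹' {z.1})
        + ε / (C + 1) * (P.law (memoryState W p g)).real Set.univ := by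
    intro g
    have h1 : ∀ h, f g (c h) = ∑ z : c.range, (c ⁻¹' {z.1}).indicator (fun _ => f g z.1) h := by
      intro h
      rw [Finset.sum_eq_single ⟨c h, c.mem_range_self h⟩]
      · simp
      · intro z _ hz
        refine Set.indicator_of_notMem (fun hh => hz ?_) _
        exact Subtype.ext (by simpa using hh.symm)
      · simp
    have hi : ∀ z : c.range, Integrable ((c ⁻¹' {z.1}).indicator fun _ => f g z.1)
        (P.law (memoryState W p g)) :=
      fun z => (integrable_const _).indicator (c.measurableSet_fiber z)
    have hi' : Integrable (fun h => f g (c h)) (P.law (memoryState W p g)) := by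
      simp_rw [h1]
      exact integrable_finsetSum _ fun z _ => hi z
    calc ∫ h, f g h ∂(P.law (memoryState W p g))
        ≤ ∫ h, (f g (c h) + ε / (C + 1)) ∂(P.law (memoryState W p g)) := by
          refine integral_mono (integrable_of_continuous _ (by fun_prop))
            (hi'.add (integrable_const _)) fun h => ?_
          have := (abs_lt.1 (hc g h)).2
          simp only
          linarith
      _ = _ := by
          rw [integral_add hi' (integrable_const _)]
          simp_rw [h1]
          rw [integral_finsetSum _ fun z _ => hi z, integral_const, smul_eq_mul, mul_comm]
          congr 1
          · refine Finset.sum_congr rfl fun z _ => ?_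
            rw [integral_indicator_const _ (c.measurableSet_fiber z), smul_eq_mul, mul_comm]
  have hcz : ∀ z : c.range,
      Continuous fun g => f g z.1 * (P.law (memoryState W p g)).real (c ⁻¹' {z.1}) := fun z =>
    (hf.comp (continuous_id.prodMk continuous_const)).mul (hlaw _ (c.measurableSet_fiber z))
  have hcu := hlaw _ MeasurableSet.univ
  calc estimationFidelity μ U (memoryState W p) P
      ≤ ∫ g, (∑ z : c.range, f g z.1 * (P.law (memoryState W p g)).real (c ⁻¹' {z.1})
        + ε / (C + 1) * (P.law (memoryState W p g)).real Set.univ) ∂μ := by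
        -- This form of monotonicity needs integrability of the upper bound only, so none is
        -- required of the inner integral as a function of `g`.
        refine integral_mono_of_nonneg (.of_forall fun g => ?_)
          (integrable_of_continuous μ (by fun_prop)) (.of_forall hinner)
        exact integral_nonneg fun h => by positivity
    _ = (1 / (d : ℝ) ^ 2) * (∑ z : c.range, ∫ g, ‖((U g : Matrix (Fin d) (Fin d) ℂ)ᴴ *
        (U z.1 : Matrix (Fin d) (Fin d) ℂ)).trace‖ ^ 2 *
        (P.law (memoryState W p g)).real (c ⁻¹' {z.1}) ∂μ) + ε / (C + 1) * C := by
        rw [integral_add (integrable_of_continuous μ (by fun_prop))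
          (integrable_of_continuous μ (by fun_prop)), integral_const_mul,
          integral_finsetSum _ fun z _ => integrable_of_continuous μ (hcz z), Finset.mul_sum]
        congr 1
        refine Finset.sum_congr rfl fun z _ => ?_
        rw [← integral_const_mul]
        congr 1
        ext g
        simp only [f, div_pow]
        ring
    _ ≤ _ := by
        refine add_le_add (mul_le_mul_of_nonneg_left
          (sum_integral_fidelity_mul_law_le μ hU contW hV irrW p hp P c) (by positivity)) ?_
        rw [div_mul_eq_mul_div, div_le_iff₀ (by linarith)]
        nlinarith

end Estimation

/-! ### The optimal measurement and the measure-and-rotate channel -/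

section Optimal

variable {G : Type*} [Group G] [TopologicalSpace G] [IsTopologicalGroup G]
    [CompactSpace G] [MeasurableSpace G] [BorelSpace G] (μ : Measure G) [μ.IsHaarMeasure]
    [IsProbabilityMeasure μ] {d : ℕ} {U : URep G (Fin d)}
    {κ : Type*} [Fintype κ] {e : κ → ℕ} {V : (K : κ) → URep G (Fin (e K))}
    {ι : Type*} [Fintype ι] [DecidableEq ι] {dim : ι → ℕ} {W : (j : ι) → URep G (Fin (dim j))}

theorem continuous_etaVec {G : Type*} [Group G] [TopologicalSpace G] {ι : Type*} {dim : ι → ℕ}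
    {W : (j : ι) → URep G (Fin (dim j))} (contW : ∀ j, Continuous (W j)) (x : Mem dim) :
    Continuous fun g => etaVec W g x :=
  continuous_const.mul (URep.continuous_apply (contW _) _ _)

/-- Schur orthogonality: the weights `√d_j` in `η` cancel the `1 / d_j` of the relations, so the `η`
resolve the identity. -/
theorem integral_etaVec {ι : Type*} [DecidableEq ι] {dim : ι → ℕ}
    {W : (j : ι) → URep G (Fin (dim j))} (contW : ∀ j, Continuous (W j))
    (irrW : ∀ j, (W j).toRep.IsIrreducible)
    (ineqW : ∀ j j', j ≠ j' → IsEmpty ((W j).toRep.Equiv (W j').toRep)) (hd : ∀ j, 0 < dim j)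
    (x y : Mem dim) :
    ∫ g, etaVec W g x * starRingEnd ℂ (etaVec W g y) ∂μ = if x = y then 1 else 0 := by
  have h : ∀ g, etaVec W g x * starRingEnd ℂ (etaVec W g y)
      = (Real.sqrt (dim x.1) * Real.sqrt (dim y.1) : ℂ) *
        ((W x.1 g : Matrix (Fin (dim x.1)) (Fin (dim x.1)) ℂ) x.2.1 x.2.2 *
      starRingEnd ℂ ((W y.1 g : Matrix (Fin (dim y.1)) (Fin (dim y.1)) ℂ) y.2.1 y.2.2)) := by
    intro g
    simp only [etaVec, dket, map_mul, Complex.conj_ofReal]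
    ring
  simp_rw [h]
  rw [integral_const_mul, integral_entries μ contW irrW ineqW]
  split_ifs with hxy
  · subst hxy
    have : (dim x.1 : ℂ) ≠ 0 := by exact_mod_cast (hd x.1).ne'
    rw [← Complex.ofReal_mul, Real.mul_self_sqrt (by positivity)]
    simp [this]
  · simp

/-- The average over the group of the joint overlap does not depend on the memory state. -/
theorem integral_overlap (hU : Continuous U) (contW : ∀ j, Continuous (W j))
    (hV : IsIrrList V (fun j : ι => U.tensor (W j).conj)) (hd : ∀ j, 0 < dim j)
    (p : ι → ℝ) (g : G) :
    ∫ h, (‖((U g : Matrix (Fin d) (Fin d) ℂ)ᴴ * (U h : Matrix (Fin d) (Fin d) ℂ)).trace‖ *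
      ‖star (memoryState W p g) ⬝ᵥ etaVec W h‖) ^ 2 ∂μ
      = ∑ K, (∑ j, (multiplicity (V K) (U.tensor (W j).conj) : ℝ) * Real.sqrt (p j)) ^ 2 := by
  rw [← integral_norm_sq_trace_mul μ hU contW hV]
  simp_rw [URep.conjTranspose_mul, star_memoryState_dotProduct_etaVec W p hd]
  exact integral_mul_left_eq_self (fun k => (‖(U k : Matrix (Fin d) (Fin d) ℂ).trace‖ *
    ‖∑ j, (Real.sqrt (p j) : ℂ) *
      (W j k : Matrix (Fin (dim j)) (Fin (dim j)) ℂ).trace‖) ^ 2) g⁻¹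

/-- With the density inserted, the integral over outcomes is `integral_overlap`, the same for every
true `g`, so the outer average is trivial. -/
theorem estimationFidelity_eq (hU : Continuous U) (contW : ∀ j, Continuous (W j))
    (hV : IsIrrList V (fun j : ι => U.tensor (W j).conj)) (hd : ∀ j, 0 < dim j)
    (p : ι → ℝ) (P : POVM G (Mem dim)) (hP : P.HasDensity μ fun g => ketbra (etaVec W g)) :
    estimationFidelity μ U (memoryState W p) P = (1 / (d : ℝ) ^ 2) *
      ∑ K, (∑ j, (multiplicity (V K) (U.tensor (W j).conj) : ℝ) * Real.sqrt (p j)) ^ 2 := by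
  have hcη := continuous_etaVec contW
  have h : ∀ g, ∫ h, (‖((U g : Matrix (Fin d) (Fin d) ℂ)ᴴ *
      (U h : Matrix (Fin d) (Fin d) ℂ)).trace‖ / (d : ℝ)) ^ 2 ∂(P.law (memoryState W p g))
      = (1 / (d : ℝ) ^ 2) *
      ∑ K, (∑ j, (multiplicity (V K) (U.tensor (W j).conj) : ℝ) * Real.sqrt (p j)) ^ 2 := by
    intro g
    have hc : Continuous fun h => ‖star (memoryState W p g) ⬝ᵥ etaVec W h‖ ^ 2 := by
      simp only [dotProduct]
      fun_prop
    rw [POVM.law_eq_withDensity μ P _ hP, integral_withDensity_eq_integral_toReal_smul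
      hc.measurable.ennreal_ofReal (.of_forall fun _ => ENNReal.ofReal_lt_top),
      ← integral_overlap μ hU contW hV hd p g, ← integral_const_mul]
    congr 1
    ext h
    rw [ENNReal.toReal_ofReal (by positivity), smul_eq_mul]
    ring
  simp_rw [estimationFidelity, h]
  simp

/-- The Kraus operator `U ⊗ ⟨η|` of the measure-and-rotate channel. -/
def rotateKraus {H M : Type*} (A : Matrix H H ℂ) (η : M → ℂ) : Matrix H (H × M) ℂ :=
  Matrix.of fun x y => jointVec A η (x, y)

/-- Identifies the Kraus form, convenient for complete positivity and fidelity, with the operational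
one: measure, then rotate. -/
theorem rotateKraus_mul_mul_conjTranspose {H M : Type*} [Fintype H] [DecidableEq H] [Fintype M]
    (A : Matrix H H ℂ) (η : M → ℂ) (ρ : Matrix (H × M) (H × M) ℂ) :
    rotateKraus A η * ρ * (rotateKraus A η)ᴴ
      = A * traceRight (((1 : Matrix H H ℂ) ⊗ₖ ketbra η) * ρ) * Aᴴ := by
  have htr : ∀ a b, traceRight (((1 : Matrix H H ℂ) ⊗ₖ ketbra η) * ρ) a b
      = ∑ k, ∑ l, η k * starRingEnd ℂ (η l) * ρ (a, l) (b, k) := by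
    intro a b
    simp [traceRight, Matrix.mul_apply, Fintype.sum_prod_type, Matrix.one_apply, ketbra,
      Matrix.vecMulVec_apply]
  generalize traceRight (((1 : Matrix H H ℂ) ⊗ₖ ketbra η) * ρ) = T at htr
  ext x y
  simp only [Matrix.mul_apply, htr, Matrix.conjTranspose_apply, rotateKraus, jointVec, Matrix.of_apply,
    Fintype.sum_prod_type, Finset.sum_mul, Finset.mul_sum]
  refine Finset.sum_congr rfl fun b _ => ?_
  rw [Finset.sum_comm]
  refine Finset.sum_congr rfl fun a _ => Finset.sum_congr rfl fun k _ =>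
    Finset.sum_congr rfl fun l _ => ?_
  simp
  ring

theorem integral_conjTranspose_rotateKraus_mul {ι : Type*} [DecidableEq ι] {dim : ι → ℕ}
    {W : (j : ι) → URep G (Fin (dim j))} (contW : ∀ j, Continuous (W j))
    (irrW : ∀ j, (W j).toRep.IsIrreducible)
    (ineqW : ∀ j j', j ≠ j' → IsEmpty ((W j).toRep.Equiv (W j').toRep)) (hd : ∀ j, 0 < dim j)
    (a b : Fin d × Mem dim) :
    ∫ g, ((rotateKraus (U g : Matrix (Fin d) (Fin d) ℂ) (etaVec W g))ᴴ *
      rotateKraus (U g : Matrix (Fin d) (Fin d) ℂ) (etaVec W g)) a b ∂μ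
      = (1 : Matrix (Fin d × Mem dim) (Fin d × Mem dim) ℂ) a b := by
  have h : ∀ g, ((rotateKraus (U g : Matrix (Fin d) (Fin d) ℂ) (etaVec W g))ᴴ *
      rotateKraus (U g : Matrix (Fin d) (Fin d) ℂ) (etaVec W g)) a b
      = (1 : Matrix (Fin d) (Fin d) ℂ) a.1 b.1 *
        (etaVec W g a.2 * starRingEnd ℂ (etaVec W g b.2)) := by
    intro g
    rw [← Matrix.mem_unitaryGroup_iff'.1 (U g).2]
    simp only [Matrix.mul_apply, Matrix.conjTranspose_apply, rotateKraus, jointVec, Matrix.of_apply,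
      Matrix.star_apply, Finset.sum_mul, star_mul', Complex.star_def, Complex.conj_conj]
    refine Finset.sum_congr rfl fun x _ => ?_
    ring
  simp_rw [h]
  rw [integral_const_mul, integral_etaVec μ contW irrW ineqW hd, Matrix.one_apply, Matrix.one_apply]
  obtain ⟨a, m⟩ := a
  obtain ⟨b, n⟩ := b
  by_cases h1 : a = b <;> by_cases h2 : m = n <;> simp [h1, h2]

theorem exists_povm_hasDensity (contW : ∀ j, Continuous (W j))
    (irrW : ∀ j, (W j).toRep.IsIrreducible)
    (ineqW : ∀ j j', j ≠ j' → IsEmpty ((W j).toRep.Equiv (W j').toRep)) (hd : ∀ j, 0 < dim j) :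
    ∃ P : POVM G (Mem dim), P.HasDensity μ fun g => ketbra (etaVec W g) := by
  have hcη := continuous_etaVec contW
  refine ⟨_, POVM.hasDensity_ofDensity μ (fun g => ketbra (etaVec W g))
    (fun x y => integrable_of_continuous μ ?_)
    (fun g => Matrix.posSemidef_vecMulVec_self_star _) ?_⟩
  · simp only [ketbra, Matrix.vecMulVec_apply, Pi.star_apply]
    fun_prop
  · ext x y
    exact integral_etaVec μ contW irrW ineqW hd x y

theorem integrable_rotateKraus {G : Type*} [Group G] [TopologicalSpace G] [CompactSpace G]
    [MeasurableSpace G] [BorelSpace G] (μ : Measure G) [IsProbabilityMeasure μ] {U : URep G (Fin d)}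
    {ι : Type*} {dim : ι → ℕ} {W : (j : ι) → URep G (Fin (dim j))} (hU : Continuous U) (contW : ∀ j, Continuous (W j))
    (x y : Fin d) (a b : Fin d × Mem dim) :
    Integrable (fun g => rotateKraus (U g : Matrix (Fin d) (Fin d) ℂ) (etaVec W g) x a *
      starRingEnd ℂ (rotateKraus (U g : Matrix (Fin d) (Fin d) ℂ) (etaVec W g) y b)) μ := by
  have hcη := continuous_etaVec contW
  have hcU := URep.continuous_apply hU
  refine integrable_of_continuous μ ?_
  simp only [rotateKraus, jointVec, Matrix.of_apply]
  fun_prop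

/-- The overlap of a Kraus operator with `jointVec` splits into the two factors of
`integral_overlap`: retrieving by measure-and-rotate scores exactly as estimation does. -/
theorem learningFidelity_eq (hU : Continuous U) (contW : ∀ j, Continuous (W j))
    (hV : IsIrrList V (fun j : ι => U.tensor (W j).conj)) (hd : ∀ j, 0 < dim j) (p : ι → ℝ)
    (hK : ∀ x y a b, Integrable (fun g =>
      rotateKraus (U g : Matrix (Fin d) (Fin d) ℂ) (etaVec W g) x a *
      starRingEnd ℂ (rotateKraus (U g : Matrix (Fin d) (Fin d) ℂ) (etaVec W g) y b)) μ)
    (hone : ∀ a b, ∫ g, ((rotateKraus (U g : Matrix (Fin d) (Fin d) ℂ) (etaVec W g))ᴴ *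
      rotateKraus (U g : Matrix (Fin d) (Fin d) ℂ) (etaVec W g)) a b ∂μ
      = (1 : Matrix (Fin d × Mem dim) (Fin d × Mem dim) ℂ) a b) :
    learningFidelity μ U (memoryState W p) (QChannel.ofKraus μ
      (fun g => rotateKraus (U g : Matrix (Fin d) (Fin d) ℂ) (etaVec W g)) hK hone)
      = (1 / (d : ℝ) ^ 2) *
      ∑ K, (∑ j, (multiplicity (V K) (U.tensor (W j).conj) : ℝ) * Real.sqrt (p j)) ^ 2 := by
  rw [learningFidelity]
  congr 1
  simp_rw [expectation_choi_ofKraus]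
  have h : ∀ g h, ‖∑ y, starRingEnd ℂ (jointVec (U g : Matrix (Fin d) (Fin d) ℂ)
      (memoryState W p g) y) *
        rotateKraus (U h : Matrix (Fin d) (Fin d) ℂ) (etaVec W h) y.1 y.2‖
      = ‖((U g : Matrix (Fin d) (Fin d) ℂ)ᴴ * (U h : Matrix (Fin d) (Fin d) ℂ)).trace‖ *
      ‖star (memoryState W p g) ⬝ᵥ etaVec W h‖ := by
    intro g h
    rw [← Complex.norm_conj (star _ ⬝ᵥ _), ← norm_mul, ← sum_jointVec_mul]
    rfl
  simp_rw [h, integral_overlap μ hU contW hV hd p]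
  simp

end Optimal

end

end UnitaryLearning

open UnitaryLearning

/-! ### The theorem -/

theorem theorem1 {G : Type*} [Group G] [TopologicalSpace G] [IsTopologicalGroup G]
    [CompactSpace G] [MeasurableSpace G] [BorelSpace G]
    (μ : MeasureTheory.Measure G) [μ.IsHaarMeasure] [MeasureTheory.IsProbabilityMeasure μ]
    {d : ℕ} (hd : 0 < d) (U : URep G (Fin d)) (hU : Continuous U) (N : ℕ)
    {ι : Type*} [Fintype ι] [DecidableEq ι] {dim : ι → ℕ}
    (W : (j : ι) → URep G (Fin (dim j)))
    (hW : IsIrrList W (fun _ : Unit => U.tensorPow N))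
    {κ : Type*} [Fintype κ] {e : κ → ℕ}
    (V : (K : κ) → URep G (Fin (e K)))
    (hV : IsIrrList V (fun j : ι => U.tensor (W j).conj))
    (p : ι → ℝ) (hp : p ∈ stdSimplex ℝ ι) :
    ∃ (P : POVM G (Mem dim)) (R : QChannel (Fin d × Mem dim) (Fin d)),
      P.HasDensity μ (fun g => ketbra (etaVec W g)) ∧
      IsMeasureAndRotate μ U (fun g => ketbra (etaVec W g)) R ∧
      (∀ R' : QChannel (Fin d × Mem dim) (Fin d),
        learningFidelity μ U (memoryState W p) R' ≤ learningFidelity μ U (memoryState W p) R) ∧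
      (∀ P' : POVM G (Mem dim),
        estimationFidelity μ U (memoryState W p) P' ≤
          estimationFidelity μ U (memoryState W p) P) ∧
      learningFidelity μ U (memoryState W p) R = estValue U W V p ∧
      estimationFidelity μ U (memoryState W p) P = estValue U W V p := by
  have contW := hW.continuous
  have irrW := hW.irreducible
  have hdim : ∀ j, 0 < dim j := fun j => by
    have := nonempty_of_irreducible (irrW j)
    simpa using Fintype.card_pos (α := Fin (dim j))
  obtain ⟨P, hP⟩ := exists_povm_hasDensity μ contW irrW hW.inequivalent hdim
  have hK := integrable_rotateKraus (W := W) μ hU contW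
  have hone := integral_conjTranspose_rotateKraus_mul (U := U) μ contW irrW hW.inequivalent hdim
  have hF := learningFidelity_eq μ hU contW hV hdim p hK hone
  have hE := estimationFidelity_eq μ hU contW hV hdim p P hP
  refine ⟨P, QChannel.ofKraus μ _ hK hone, hP, fun ρ x y => ?_, fun R' => ?_, fun P' => ?_, ?_, ?_⟩
  · simp_rw [← rotateKraus_mul_mul_conjTranspose]
    exact ⟨integrable_kraus hK ρ x y, rfl⟩
  · rw [hF]
    exact learningFidelity_le μ hU contW hV irrW p hp.1 R'
  · rw [hE]
    exact estimationFidelity_le μ hU contW hV irrW p hp.1 P'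
  · rw [hF, estValue_eq U W V hV.irreducible]
  · rw [hE, estValue_eq U W V hV.irreducible]
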